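/- Setting. Let $X,Y$ be finite-dimensional real inner product spaces, $K:X\to Y$ linear with adjoint $K^\top$, and let $g:X\to(-\infty,+\infty]$ and $f:Y\to(-\infty,+\infty]$ be closed proper convex functions, with $f^*(y)=\sup_{u\in Y}\{\langle y,u\rangle-f(u)\}$. Assume that the primal problem $\min_{x\in X} g(x)+f(Kx)$ has a solution, and that there is $\tilde x\in\mathrm{ri}(\mathrm{dom}\,g)$ with $K\tilde x\in\mathrm{ri}(\mathrm{dom}\,f)$. Put $\mathcal L(x,y)=g(x)+\langle Kx,y\rangle-f^*(y)$; a pair $(\bar x,\bar y)$ is a saddle point if $\mathcal L(\bar x,y)\le\mathcal L(\bar x,\bar y)\le\mathcal L(x,\bar y)$ for all $(x,y)\in X\times Y$. For a saddle point $(\bar x,\bar y)$ let $G(x,y)=\mathcal L(x,\bar y)-\mathcal L(\bar x,y)$. Assume that $g$ is $\gamma_g$-strongly convex for some $\gamma_g>0$, i.e. $g(x')\ge g(x)+\langle u,x'-x\rangle+\frac{\gamma_g}{2}\|x'-x\|^2$ for all $x,x'\in X$ and $u\in\partial g(x)$. Write $\mathrm{Prox}_{\lambda h}(v)=\arg\min_w\{h(w)+\frac1{2\lambda}\|w-v\|^2\}$.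 Algorithm. Let $\psi_0=1.3247\ldots$ be the unique real root of $\psi^3-\psi-1=0$. Choose $\psi\in(\psi_0,\frac{1+\sqrt5}{2})$, $\mu\in(0,1)$, $\beta_0>0$, $\tau_0>0$, $x_0=z_0\in X$ and $y_0\in Y$, and set $\varphi=(1+\psi)/\psi^2$. For $n=1,2,\ldots$ let $$z_n=\tfrac{\psi-1}{\psi}x_{n-1}+\tfrac1\psi z_{n-1},\qquad x_n=\mathrm{Prox}_{\tau_{n-1}g}(z_n-\tau_{n-1}K^\top y_{n-1}),$$ $$\omega_n=\frac{\psi-\varphi}{\psi+\varphi\gamma_g\tau_{n-1}},\qquad \beta_n=\beta_{n-1}(1+\gamma_g\omega_n\tau_{n-1}),$$ $$y_n=\mathrm{Prox}_{\beta_n\tau_nf^*}(y_{n-1}+\beta_n\tau_nKx_n),$$ where $\tau_n=\varphi\tau_{n-1}\mu^i$ and $i$ is the smallest nonnegative integer for which $$\sqrt{\beta_n\tau_n}\,\|K^\top y_n-K^\top y_{n-1}\|\le\sqrt{\psi/\tau_{n-1}}\,\|y_n-y_{n-1}\|.$$ Theorem. Let $(z_n,x_n,y_n,\beta_n,\tau_n)_{n\ge1}$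 be generated by this algorithm. Then the primal problem has a unique solution $x^*$, every saddle point has the form $(x^*,\bar y)$, and the following hold. (a) There are constants $C_1,C_2>0$ such that $\|z_{n+1}-x^*\|\le C_1/n$ and $\|x_{n+1}-x^*\|\le C_2/n$ for all $n\ge1$. (b) The sequence $(y_n)_{n\ge1}$ is bounded, and it has a subsequence converging to some $y^*$ such that $(x^*,y^*)$ is a saddle point. (c) For every saddle point $(\bar x,\bar y)$, with $G$ the corresponding gap function, there is a constant $C_3>0$ such that $G(X_N,Y_N)\le C_3/N^2$ for every integer $N\ge1$, where $$S_N=\sum_{n=1}^N\beta_n\tau_n,\qquad X_N=\frac1{S_N}\sum_{n=1}^N\beta_n\tau_nx_n,\qquad Y_N=\frac1{S_N}\sum_{n=1}^N\beta_n\tau_ny_n.$$ -/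

import Mathlib

open Filter Topology

namespace GRPDA

noncomputable section

section Convex

variable {E : Type*} [NormedAddCommGroup E] [InnerProductSpace ℝ E]

/-- The effective domain of an extended real-valued function. -/
def dom (h : E → EReal) : Set E := {x | h x < ⊤}

/-- Closed proper convex functions with values in `(-∞, +∞]`. Convexity is convexity of the
epigraph, closedness is lower semicontinuity. -/
structure ClosedProperConvex (h : E → EReal) : Prop where
  ne_bot : ∀ x, h x ≠ ⊥
  dom_nonempty : (dom h).Nonempty
  lsc : LowerSemicontinuous h
  convex_epi : Convex ℝ {p : E × ℝ | h p.1 ≤ (p.2 : EReal)}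

/-- The subdifferential `∂h(x)`. -/
def subdiff (h : E → EReal) (x : E) : Set E :=
  {u | ∀ y, h x + ((inner ℝ u (y - x) : ℝ) : EReal) ≤ h y}

/-- `γ`-strong convexity, through subgradients. -/
def StronglyConvex (γ : ℝ) (h : E → EReal) : Prop :=
  ∀ x y, ∀ u ∈ subdiff h x,
    h x + ((inner ℝ u (y - x) + γ / 2 * ‖y - x‖ ^ 2 : ℝ) : EReal) ≤ h y

/-- The Legendre-Fenchel conjugate `f*`. -/
def conj (f : E → EReal) (y : E) : EReal :=
  ⨆ x, ((inner ℝ y x : ℝ) : EReal) - f x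

/-- `z = Prox_{lam h}(x)`: the point `z` minimizes `h + ‖· - x‖² / (2 lam)`.
For `lam > 0` and `h` closed proper convex there is exactly one such point. -/
def IsProx (lam : ℝ) (h : E → EReal) (x z : E) : Prop :=
  ∀ y, h z + ((1 / (2 * lam) * ‖z - x‖ ^ 2 : ℝ) : EReal) ≤
    h y + ((1 / (2 * lam) * ‖y - x‖ ^ 2 : ℝ) : EReal)

end Convex

section SaddlePoint

variable {X Y : Type*} [NormedAddCommGroup X] [InnerProductSpace ℝ X]
  [NormedAddCommGroup Y] [InnerProductSpace ℝ Y]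

/-- `x` solves the primal problem of minimizing `g(x) + f(Kx)`. -/
def IsPrimalSolution (g : X → EReal) (f : Y → EReal) (K : X →ₗ[ℝ] Y) (x : X) : Prop :=
  ∀ x', g x + f (K x) ≤ g x' + f (K x')

/-- The Lagrangian `L(x,y) = g(x) + ⟨Kx,y⟩ - f*(y)`. If `g(x) = f*(y) = +∞`, the value
is `-∞` by the conventions of `EReal`. -/
def lagrangian (g : X → EReal) (f : Y → EReal) (K : X →ₗ[ℝ] Y) (x : X) (y : Y) : EReal :=
  g x + ((inner ℝ (K x) y : ℝ) : EReal) - conj f y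

/-- `(xb, yb)` is a saddle point of the Lagrangian. For closed proper convex `g` and `f`
this forces `g(xb)` and `f*(yb)` to be finite. -/
def IsSaddlePoint (g : X → EReal) (f : Y → EReal) (K : X →ₗ[ℝ] Y) (xb : X) (yb : Y) : Prop :=
  ∀ x y, lagrangian g f K xb y ≤ lagrangian g f K xb yb ∧
    lagrangian g f K xb yb ≤ lagrangian g f K x yb

/-- The primal-dual gap function `G(x,y) = L(x,yb) - L(xb,y)`. At a saddle point `(xb, yb)`
the first term is never `-∞` and the second is never `+∞`, so the difference is never
an indeterminate form. -/
def gap (g : X → EReal) (f : Y → EReal) (K : X →ₗ[ℝ] Y) (xb : X) (yb : Y)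
    (x : X) (y : Y) : EReal :=
  lagrangian g f K x yb - lagrangian g f K xb y

end SaddlePoint

section Algorithm

variable {X Y : Type*} [NormedAddCommGroup X] [InnerProductSpace ℝ X] [FiniteDimensional ℝ X]
  [NormedAddCommGroup Y] [InnerProductSpace ℝ Y] [FiniteDimensional ℝ Y]

/-- The factor `φ = (1 + ψ) / ψ²`. -/
def stepFactor (ψ : ℝ) : ℝ := (1 + ψ) / ψ ^ 2

/-- `yNew` is the trial dual point with stepsize `t`, computed from the previous dual point
`yOld`, the current primal point `xNew` and the current parameter `b`. -/
def IsDualTrial (f : Y → EReal) (K : X →ₗ[ℝ] Y) (b t : ℝ) (xNew : X) (yOld yNew : Y) : Prop :=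
  IsProx (b * t) (conj f) (yOld + (b * t) • K xNew) yNew

/-- The acceptance test of the linesearch for the trial stepsize `t`, the trial point `yNew` and
the previous stepsize `tOld`. -/
def Accepts (K : X →ₗ[ℝ] Y) (ψ b tOld t : ℝ) (yOld yNew : Y) : Prop :=
  √(b * t) * ‖LinearMap.adjoint K yNew - LinearMap.adjoint K yOld‖ ≤
    √(ψ / tOld) * ‖yNew - yOld‖

/-- The linesearch step: the new stepsize is `φ tOld μ ^ i`, where `i` is the smallest natural
number for which the trial point passes the acceptance test. -/
def IsLinesearchStep (f : Y → EReal) (K : X →ₗ[ℝ] Y) (ψ μ b tOld t : ℝ)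
    (xNew : X) (yOld yNew : Y) : Prop :=
  ∃ i : ℕ, t = stepFactor ψ * tOld * μ ^ i ∧
    IsDualTrial f K b t xNew yOld yNew ∧ Accepts K ψ b tOld t yOld yNew ∧
    ∀ j < i, ∀ y', IsDualTrial f K b (stepFactor ψ * tOld * μ ^ j) xNew yOld y' →
      ¬ Accepts K ψ b tOld (stepFactor ψ * tOld * μ ^ j) yOld y'

/-- The sequences `z, x, y, ω, β, τ` are generated by the accelerated golden ratio primal-dual
algorithm with linesearch, with parameters `γ`, `ψ`, `μ`. The starting data are
`x 0 = z 0`, `y 0`, `β 0 > 0` and `τ 0 > 0`; the value `ω 0` is not used. -/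
structure IsAcceleratedRun (g : X → EReal) (f : Y → EReal) (K : X →ₗ[ℝ] Y) (γ ψ μ : ℝ)
    (z x : ℕ → X) (y : ℕ → Y) (ω β τ : ℕ → ℝ) : Prop where
  start : x 0 = z 0
  beta_pos : 0 < β 0
  tau_pos : 0 < τ 0
  z_step : ∀ n, z (n + 1) = ((ψ - 1) / ψ) • x n + (1 / ψ) • z n
  x_step : ∀ n, IsProx (τ n) g (z (n + 1) - τ n • LinearMap.adjoint K (y n)) (x (n + 1))
  omega_step : ∀ n, ω (n + 1) = (ψ - stepFactor ψ) / (ψ + stepFactor ψ * γ * τ n)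
  beta_step : ∀ n, β (n + 1) = β n * (1 + γ * ω (n + 1) * τ n)
  y_step : ∀ n, IsLinesearchStep f K ψ μ (β (n + 1)) (τ n) (τ (n + 1))
    (x (n + 1)) (y n) (y (n + 1))

end Algorithm

section Ergodic

variable {V : Type*} [NormedAddCommGroup V] [InnerProductSpace ℝ V]

/-- The total weight `S_N = ∑_{n=1}^N β_n τ_n`. -/
def totalWeight (β τ : ℕ → ℝ) (N : ℕ) : ℝ := ∑ n ∈ Finset.Icc 1 N, β n * τ n

/-- The weighted average `(1 / S_N) ∑_{n=1}^N β_n τ_n v_n`. -/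
def ergodicMean (β τ : ℕ → ℝ) (v : ℕ → V) (N : ℕ) : V :=
  (1 / totalWeight β τ N) • ∑ n ∈ Finset.Icc 1 N, (β n * τ n) • v n

end Ergodic

end

end GRPDA

/-! The relative interior condition gives a dual solution, hence a saddle point; strong convexity
makes its primal component unique. Relative to a saddle point, `energy` weighs `‖z (n + 2) - xb‖ ^
2` by roughly `β (n + 1)` and adds `‖y n - yb‖ ^ 2`. It decreases at each step by at least `2 β τ`
times the gap plus two weighted residuals (`energy_inequality`, `IsAcceleratedRun.energy_succ_le`):
the linesearch test absorbs the coupling term, and the rule for `ω` matches the weights of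
successive energies. Therefore the dual iterates are bounded, `β n ‖z (n + 1) - xb‖ ^ 2` is bounded,
and the weighted gaps have bounded sum.

The rates then reduce to `√(β n) ≥ c n` and `S_N ≥ c N ^ 2`. No uniform lower bound on `√(β n) * τ
n` is needed. On the logarithmic scale, with a suitable shift, let `a n` be `log (√(β n) * τ n)`. If
the first trial is accepted, `a` rises by at least `log φ`; otherwise the rejected previous trial
forces `a (n + 1) ≥ -a n`. A potential argument (`linear_growth_of_reflection`) shows that `a n ≥ 0`
at a positive proportion of indices, and at each of them `√β` gains a fixed amount. The increments
of `β` are at most a multiple of `β τ`, so telescoping gives the growth of `S_N`.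

For a dual cluster point one uses infinitely many indices where `√β τ` is bounded below and a
neighbouring stepsize ratio gives a residual a positive weight. There the residuals divided by the
stepsizes tend to zero, and closedness of the subdifferential graphs yields the optimality
conditions in the limit. -/

namespace GRPDA

/-! ### Extended real values and limits. -/

section ExtendedReal

theorem exists_coe_eq {a : EReal} (h₁ : a ≠ ⊤) (h₂ : a ≠ ⊥) : ∃ r : ℝ, a = r :=
  ⟨a.toReal, (EReal.coe_toReal h₁ h₂).symm⟩

theorem le_of_forall_small_le_add_mul {a b c : ℝ}
    (h : ∀ t : ℝ, 0 < t → t ≤ 1 → a ≤ b + t * c) : a ≤ b := by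
  have hlim : Tendsto (fun t : ℝ => b + t * c) (𝓝[>] 0) (𝓝 b) := by
    have : Tendsto (fun t : ℝ => b + t * c) (𝓝 0) (𝓝 (b + 0 * c)) :=
      Continuous.tendsto (by fun_prop) 0
    rw [zero_mul, add_zero] at this
    exact this.mono_left nhdsWithin_le_nhds
  refine ge_of_tendsto hlim ?_
  filter_upwards [Ioc_mem_nhdsGT (zero_lt_one (α := ℝ))] with t ht
  exact h t ht.1 ht.2

theorem tendsto_le_of_lowerSemicontinuous {T : Type*} [TopologicalSpace T] {h : T → EReal}
    (hh : LowerSemicontinuous h)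
    {v : ℕ → T} {w : T} (hv : Tendsto v atTop (𝓝 w)) {r : ℕ → ℝ} {b : ℝ}
    (hr : Tendsto r atTop (𝓝 b)) (hle : ∀ n, h (v n) ≤ r n) : h w ≤ b := by
  by_contra hlt
  push Not at hlt
  obtain ⟨c, hc1, hc2⟩ := EReal.lt_iff_exists_real_btwn.1 hlt
  have h1 : ∀ᶠ n in atTop, (c : EReal) < h (v n) := hv.eventually (hh w c hc2)
  have h2 : ∀ᶠ n in atTop, r n < c := hr.eventually_lt_const (by exact_mod_cast hc1)
  obtain ⟨n, hn1, hn2⟩ := (h1.and h2).exists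
  have h3 := hn1.trans_le (hle n)
  exact lt_asymm hn2 (by exact_mod_cast h3)

end ExtendedReal

/-! ### Subgradients, conjugates, proximal points and relative interiors. -/

section Convex

variable {E : Type*} [NormedAddCommGroup E] [InnerProductSpace ℝ E]

theorem ClosedProperConvex.le_combo {h : E → EReal} (hh : ClosedProperConvex h) {x y : E}
    {r s a b : ℝ} (hx : h x ≤ r) (hy : h y ≤ s) (ha : 0 ≤ a) (hb : 0 ≤ b) (hab : a + b = 1) :
    h (a • x + b • y) ≤ ((a * r + b * s : ℝ) : EReal) := by
  have := hh.convex_epi (x := (x, r)) hx (y := (y, s)) hy ha hb hab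
  simpa using this

theorem ClosedProperConvex.le_sum {h : E → EReal} (hh : ClosedProperConvex h) {ι : Type*}
    (t : Finset ι) (w r : ι → ℝ) (v : ι → E) (hw : ∀ i ∈ t, 0 ≤ w i) (hw' : ∑ i ∈ t, w i = 1)
    (hr : ∀ i ∈ t, h (v i) ≤ r i) :
    h (∑ i ∈ t, w i • v i) ≤ ((∑ i ∈ t, w i * r i : ℝ) : EReal) := by
  have := hh.convex_epi.sum_mem hw hw' (z := fun i => (v i, r i)) hr
  simpa [Prod.fst_sum, Prod.snd_sum] using this

theorem subdiff_le {h : E → EReal} {x y u : E} {a b : ℝ} (hu : u ∈ subdiff h x)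
    (hx : h x = a) (hy : h y = b) : a + inner ℝ u (y - x) ≤ b := by
  have := hu y
  rw [hx, hy] at this
  exact_mod_cast this

theorem StronglyConvex.le {h : E → EReal} {γ : ℝ} (hh : StronglyConvex γ h) {x y u : E} {a b : ℝ}
    (hu : u ∈ subdiff h x) (hx : h x = a) (hy : h y = b) :
    a + (inner ℝ u (y - x) + γ / 2 * ‖y - x‖ ^ 2) ≤ b := by
  have := hh x y u hu
  rw [hx, hy] at this
  exact_mod_cast this

theorem mem_subdiff_of_forall_real {h : E → EReal} {x u : E} {a : ℝ} (hbot : ∀ y, h y ≠ ⊥)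
    (hx : h x = a) (H : ∀ y (b : ℝ), h y = b → a + inner ℝ u (y - x) ≤ b) : u ∈ subdiff h x := by
  intro y
  by_cases hy : h y = ⊤
  · rw [hy]; exact le_top
  · obtain ⟨b, hb⟩ := exists_coe_eq hy (hbot y)
    rw [hx, hb]
    exact_mod_cast H y b hb

theorem IsProx.ne_top {h : E → EReal} (hh : ClosedProperConvex h) {lam : ℝ} {v z : E}
    (hz : IsProx lam h v z) : h z ≠ ⊤ := by
  obtain ⟨y, hy⟩ := hh.dom_nonempty
  intro hz'
  have := hz y
  rw [hz', EReal.top_add_coe, top_le_iff] at this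
  exact EReal.add_ne_top (ne_of_lt hy) (EReal.coe_ne_top _) this

/-- Compare `z` with a point at parameter `t` on the segment towards `y`, divide by `t` and let `t →
0`; the quadratic term contributes only `O(t)`. -/
theorem IsProx.mem_subdiff {h : E → EReal} (hh : ClosedProperConvex h) {lam : ℝ} (hlam : 0 < lam)
    {v z : E} (hz : IsProx lam h v z) : (1 / lam) • (v - z) ∈ subdiff h z := by
  obtain ⟨a, ha⟩ := exists_coe_eq (hz.ne_top hh) (hh.ne_bot z)
  refine mem_subdiff_of_forall_real hh.ne_bot ha fun y b hb => ?_
  refine le_of_forall_small_le_add_mul (c := 1 / (2 * lam) * ‖y - z‖ ^ 2) fun t ht ht1 => ?_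
  have hc : h ((1 - t) • z + t • y) ≤ (((1 - t) * a + t * b : ℝ) : EReal) :=
    hh.le_combo ha.le hb.le (by linarith) ht.le (by ring)
  have h1 := hz ((1 - t) • z + t • y)
  have h2 := h1.trans (add_le_add_left hc _)
  rw [ha] at h2
  have h3 : a + 1 / (2 * lam) * ‖z - v‖ ^ 2 ≤
      (1 - t) * a + t * b + 1 / (2 * lam) * ‖(1 - t) • z + t • y - v‖ ^ 2 := by exact_mod_cast h2
  have h4 : (1 - t) • z + t • y - v = (z - v) + t • (y - z) := by module
  rw [h4, norm_add_sq_real, norm_smul, inner_smul_right, mul_pow, Real.norm_eq_abs, sq_abs] at h3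
  have h5 : inner ℝ ((1 / lam) • (v - z)) (y - z) = -(1 / lam) * inner ℝ (z - v) (y - z) := by
    rw [inner_smul_left, ← neg_sub z v, inner_neg_left]; simp
  rw [h5]
  have h6 : t * (a - b) ≤ t * (1 / lam * inner ℝ (z - v) (y - z) +
      t * (1 / (2 * lam) * ‖y - z‖ ^ 2)) := by
    have : 1 / lam = 2 * (1 / (2 * lam)) := by field_simp
    rw [this]; nlinarith
  have h7 := le_of_mul_le_mul_left h6 ht
  linarith

theorem conj_ge (f : E → EReal) (y x : E) {b : ℝ} (hx : f x = b) :
    ((inner ℝ y x - b : ℝ) : EReal) ≤ conj f y := by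
  have := le_iSup (fun x => ((inner ℝ y x : ℝ) : EReal) - f x) x
  rw [hx] at this
  exact_mod_cast this

theorem conj_le {f : E → EReal} (hf : ∀ x, f x ≠ ⊥) {y : E} {r : ℝ} :
    conj f y ≤ r ↔ ∀ x (b : ℝ), f x = b → inner ℝ y x - b ≤ r := by
  constructor
  · intro h x b hb
    exact_mod_cast (conj_ge f y x hb).trans h
  · intro h
    refine iSup_le fun x => ?_
    by_cases hx : f x = ⊤
    · rw [hx, EReal.sub_top]; exact bot_le
    · obtain ⟨b, hb⟩ := exists_coe_eq hx (hf x)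
      rw [hb]
      exact_mod_cast h x b hb

theorem ClosedProperConvex.conj_ne_bot {f : E → EReal} (hf : ClosedProperConvex f) (y : E) :
    conj f y ≠ ⊥ := by
  obtain ⟨x, hx⟩ := hf.dom_nonempty
  obtain ⟨b, hb⟩ := exists_coe_eq (ne_of_lt hx) (hf.ne_bot x)
  exact ne_bot_of_le_ne_bot (EReal.coe_ne_bot _) (conj_ge f y x hb)

theorem lowerSemicontinuous_conj {f : E → EReal} (hf : ClosedProperConvex f) :
    LowerSemicontinuous (conj f) := by
  refine lowerSemicontinuous_iSup fun x => ?_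
  by_cases hx : f x = ⊤
  · simp only [hx, EReal.sub_top]
    exact lowerSemicontinuous_const
  · obtain ⟨b, hb⟩ := exists_coe_eq hx (hf.ne_bot x)
    simp only [hb]
    have : Continuous fun y : E => ((inner ℝ y x - b : ℝ) : EReal) :=
      continuous_coe_real_ereal.comp (by fun_prop)
    exact this.lowerSemicontinuous

theorem ClosedProperConvex.conj {f : E → EReal} (hf : ClosedProperConvex f)
    (hd : (dom (conj f)).Nonempty) : ClosedProperConvex (conj f) where
  ne_bot := hf.conj_ne_bot
  dom_nonempty := hd
  lsc := lowerSemicontinuous_conj hf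
  convex_epi := by
    rintro ⟨y, r⟩ hy ⟨z, s⟩ hz a b ha hb hab
    simp only [Set.mem_ofPred_eq, Prod.smul_mk, Prod.mk_add_mk, smul_eq_mul] at hy hz ⊢
    rw [conj_le hf.ne_bot] at hy hz ⊢
    intro x c hc
    have h1 := mul_le_mul_of_nonneg_left (hy x c hc) ha
    have h2 := mul_le_mul_of_nonneg_left (hz x c hc) hb
    rw [inner_add_left, inner_smul_left, inner_smul_left]
    simp only [conj_trivial]
    have : c = a * c + b * c := by rw [← add_mul, hab, one_mul]
    linarith

/-- Existence of proximal points for lower semicontinuous functions with an affine minorant. -/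
theorem exists_isProx [FiniteDimensional ℝ E] {h : E → EReal} (hlsc : LowerSemicontinuous h)
    {u : E} {c : ℝ} (hmin : ∀ y, ((inner ℝ y u - c : ℝ) : EReal) ≤ h y) {lam : ℝ} (hlam : 0 < lam)
    (v : E) : ∃ z, IsProx lam h v z := by
  by_cases htop : ∀ y, h y = ⊤
  · exact ⟨v, fun y => by rw [htop y, EReal.top_add_coe]; exact le_top⟩
  push Not at htop
  obtain ⟨y₁, hy₁⟩ := htop
  obtain ⟨b, hb⟩ := exists_coe_eq hy₁ (ne_bot_of_le_ne_bot (EReal.coe_ne_bot _) (hmin y₁))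
  set F : E → EReal := fun y => h y + ((1 / (2 * lam) * ‖y - v‖ ^ 2 : ℝ) : EReal) with hF
  have hFlsc : LowerSemicontinuous F := by
    refine hlsc.add' ?_ ?_
    · have : Continuous fun y : E => ((1 / (2 * lam) * ‖y - v‖ ^ 2 : ℝ) : EReal) :=
        continuous_coe_real_ereal.comp (by fun_prop)
      exact this.lowerSemicontinuous
    · intro x
      exact EReal.continuousAt_add (Or.inr (EReal.coe_ne_bot _)) (Or.inr (EReal.coe_ne_top _))
  set m : ℝ := b + 1 / (2 * lam) * ‖y₁ - v‖ ^ 2 with hm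
  have hFy : F y₁ = m := by simp only [hF, hb, hm]; norm_cast
  -- With `ρ = ‖y - v‖`, this expression bounds from below the affine minorant plus the quadratic
  -- term.
  have hcoer : Tendsto (fun ρ : ℝ => ρ * (1 / (2 * lam) * ρ - ‖u‖) + (inner ℝ v u - c)) atTop
      atTop := by
    refine tendsto_atTop_add_const_right _ _ (tendsto_id.atTop_mul_atTop₀ ?_)
    exact tendsto_atTop_add_const_right _ _ (tendsto_id.const_mul_atTop (by positivity))
  obtain ⟨R, hR⟩ := (hcoer.eventually_gt_atTop m).exists_forall_of_atTop
  -- The ball contains `y₁`, so its minimum is at most `m`, while the objective is at least `m`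
  -- outside.
  have hne : (Metric.closedBall v (max R ‖y₁ - v‖)).Nonempty :=
    ⟨v, Metric.mem_closedBall_self (le_max_of_le_right (norm_nonneg _))⟩
  obtain ⟨z, -, hz⟩ := LowerSemicontinuousOn.exists_isMinOn hne
    (isCompact_closedBall _ _) (hFlsc.lowerSemicontinuousOn _)
  have hzm : F z ≤ m := by
    rw [← hFy]
    exact hz (by simp [dist_eq_norm])
  refine ⟨z, fun y => ?_⟩
  change F z ≤ F y
  by_cases hy : y ∈ Metric.closedBall v (max R ‖y₁ - v‖)
  · exact hz hy
  · refine hzm.trans ?_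
    have hy' : R ≤ ‖y - v‖ := by
      rw [Metric.mem_closedBall, dist_eq_norm, not_le] at hy
      exact (le_max_left _ _).trans hy.le
    have h1 : m ≤ inner ℝ y u - c + 1 / (2 * lam) * ‖y - v‖ ^ 2 := by
      have h2 := hR _ hy'
      have h3 : inner ℝ y u = inner ℝ (y - v) u + inner ℝ v u := by
        rw [← inner_add_left, sub_add_cancel]
      have h4 := abs_le.1 (abs_real_inner_le_norm (y - v) u)
      nlinarith [h4.1]
    calc (m : EReal) ≤ ((inner ℝ y u - c + 1 / (2 * lam) * ‖y - v‖ ^ 2 : ℝ) : EReal) := by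
          exact_mod_cast h1
      _ = ((inner ℝ y u - c : ℝ) : EReal) + ((1 / (2 * lam) * ‖y - v‖ ^ 2 : ℝ) : EReal) := by
          norm_cast
      _ ≤ F y := add_le_add_left (hmin y) _

/-- A point of `dom f` supplies the affine minorant, so properness of `conj f` is not needed.
Existence matters because the rejection clause of `IsLinesearchStep` would say nothing if no trial
point existed. -/
theorem ClosedProperConvex.exists_isProx_conj [FiniteDimensional ℝ E] {f : E → EReal}
    (hf : ClosedProperConvex f) {lam : ℝ} (hlam : 0 < lam) (v : E) :
    ∃ z, IsProx lam (GRPDA.conj f) v z := by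
  obtain ⟨x, hx⟩ := hf.dom_nonempty
  obtain ⟨b, hb⟩ := exists_coe_eq (ne_of_lt hx) (hf.ne_bot x)
  exact exists_isProx (lowerSemicontinuous_conj hf) (fun y => conj_ge f y x hb) hlam v

/-- From a relative interior point one can move slightly away from any point of the set. -/
theorem eventually_sub_smul_mem {s : Set E} {x y : E} (hx : x ∈ intrinsicInterior ℝ s)
    (hy : y ∈ s) : ∀ᶠ t : ℝ in 𝓝[>] 0, x - t • (y - x) ∈ s := by
  obtain ⟨x', hx', rfl⟩ := mem_intrinsicInterior.1 hx
  rw [mem_interior_iff_mem_nhds, mem_nhds_subtype] at hx'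
  obtain ⟨U, hU, hUs⟩ := hx'
  have hlim : Tendsto (fun t : ℝ => (x' : E) - t • (y - x')) (𝓝[>] 0) (𝓝 (x' : E)) := by
    have : Tendsto (fun t : ℝ => (x' : E) - t • (y - x')) (𝓝 0) (𝓝 ((x' : E) - (0 : ℝ) • (y - x'))) :=
      Continuous.tendsto (by fun_prop) 0
    rw [zero_smul, sub_zero] at this
    exact this.mono_left nhdsWithin_le_nhds
  filter_upwards [hlim hU] with t ht
  have hmem : (x' : E) - t • (y - x') ∈ affineSpan ℝ s := by
    have := AffineMap.lineMap_mem (-t) x'.2 (subset_affineSpan ℝ s hy)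
    rw [AffineMap.lineMap_apply, vsub_eq_sub, vadd_eq_add, neg_smul, neg_add_eq_sub] at this
    exact this
  exact hUs (a := ⟨_, hmem⟩) ht

end Convex

end GRPDA

namespace GRPDA

/-! ### Finite values of the Lagrangian. -/

section Lagrangian

variable {X Y : Type*} [NormedAddCommGroup X] [InnerProductSpace ℝ X]
  [NormedAddCommGroup Y] [InnerProductSpace ℝ Y]

theorem lagrangian_coe {g : X → EReal} {f : Y → EReal} {K : X →ₗ[ℝ] Y}
    {x : X} {y : Y} {a c : ℝ} (hx : g x = a) (hy : conj f y = c) :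
    lagrangian g f K x y = ((a + inner ℝ (K x) y - c : ℝ) : EReal) := by
  rw [lagrangian, hx, hy]; norm_cast

end Lagrangian

/-! ### Separation, saddle points and strong duality. -/

section Duality

variable {X Y : Type*} [NormedAddCommGroup X] [InnerProductSpace ℝ X]
  [NormedAddCommGroup Y] [InnerProductSpace ℝ Y] [FiniteDimensional ℝ Y]

/-- A convex set in `Y × ℝ` lying above `0` over the origin, whose projection has the origin in its
relative interior, lies above the graph of a linear functional. -/
theorem exists_inner_le_of_convex {A : Set (Y × ℝ)} (hA : Convex ℝ A) (h0 : (0, 0) ∈ A)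
    (hpos : ∀ r, ((0 : Y), r) ∈ A → 0 ≤ r)
    (hsymm : ∀ p ∈ A, ∃ t > 0, ∃ r, (-((t : ℝ) • p.1), r) ∈ A) :
    ∃ v : Y, ∀ p ∈ A, inner ℝ v p.1 ≤ p.2 := by
  set C : ConvexCone ℝ (Y × ℝ) := ConvexCone.hull ℝ A with hC
  have hCp : C.Pointed := ConvexCone.subset_hull h0
  -- The projection of the cone to `Y` is a subspace: closure under negative multiples is exactly
  -- what `hsymm` provides.
  let V : Submodule ℝ Y :=
    { carrier := {u | ∃ r, (u, r) ∈ C}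
      zero_mem' := ⟨0, hCp⟩
      add_mem' := by
        rintro u v ⟨r, hr⟩ ⟨s, hs⟩
        exact ⟨r + s, C.add_mem hr hs⟩
      smul_mem' := by
        rintro c u ⟨r, hr⟩
        rcases lt_trichotomy c 0 with hc | hc | hc
        · obtain ⟨d, hd, p, hp, hpe⟩ := (ConvexCone.mem_hull_of_convex hA).1 hr
          obtain ⟨t, ht, s, hs⟩ := hsymm p hp
          refine ⟨(-c * d / t) • s, ?_⟩
          have h1 : (-c * d / t) • (-((t : ℝ) • p.1), s) ∈ C :=
            C.smul_mem (div_pos (mul_pos (neg_pos.2 hc) hd) ht) (ConvexCone.subset_hull hs)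
          have h2 : u = d • p.1 := (congrArg Prod.fst hpe).symm
          convert h1 using 1
          rw [h2, Prod.smul_mk, smul_neg, smul_smul, smul_smul, ← neg_smul]
          congr 2
          field_simp
        · exact ⟨0, by rw [hc, zero_smul]; exact hCp⟩
        · exact ⟨c • r, C.smul_mem hc hr⟩ }
  -- Pulling the cone back along the projection onto `V` lets every vector reach it by a vertical
  -- shift, as `riesz_extension` requires. The functional to extend is the height on the vertical
  -- axis.
  let P : Y × ℝ →ₗ[ℝ] Y × ℝ := (V.starProjection : Y →ₗ[ℝ] Y).prodMap LinearMap.id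
  have hP : ∀ u r, P (u, r) = (V.starProjection u, r) := fun u r => rfl
  let S : PointedCone ℝ (Y × ℝ) := (C.toPointedCone hCp).comap P
  have hS : ∀ u r, (u, r) ∈ S ↔ (V.starProjection u, r) ∈ C := fun u r => Iff.rfl
  let F : Y × ℝ →ₗ.[ℝ] ℝ :=
    { domain := LinearMap.range (LinearMap.inr ℝ Y ℝ)
      toFun := (LinearMap.snd ℝ Y ℝ).comp (Submodule.subtype _) }
  obtain ⟨G, hG1, hG2⟩ := riesz_extension S F (by
      rintro ⟨_, ⟨r, rfl⟩⟩ hx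
      change 0 ≤ r
      change (0, r) ∈ S at hx
      rw [hS, map_zero] at hx
      obtain ⟨d, hd, p, hp, hpe⟩ := (ConvexCone.mem_hull_of_convex hA).1 hx
      have h1 : d • p.1 = 0 := congrArg Prod.fst hpe
      have h2 : d * p.2 = r := congrArg Prod.snd hpe
      have h3 : p.1 = 0 := (smul_eq_zero.1 h1).resolve_left hd.ne'
      have h4 := hpos p.2 (h3 ▸ hp)
      rw [← h2]
      positivity) (by
      rintro ⟨u, r⟩
      obtain ⟨s, hs⟩ : V.starProjection u ∈ V := Submodule.starProjection_apply_mem _ _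
      refine ⟨⟨(0, s - r), ⟨s - r, rfl⟩⟩, ?_⟩
      rw [Prod.mk_add_mk, zero_add, sub_add_cancel, hS]
      exact hs)
  have hGr : ∀ r : ℝ, G (0, r) = r := fun r => hG1 ⟨(0, r), ⟨r, rfl⟩⟩
  let ell : Y →ₗ[ℝ] ℝ := G.comp (LinearMap.inl ℝ Y ℝ)
  refine ⟨-(InnerProductSpace.toDual ℝ Y).symm ell.toContinuousLinearMap, ?_⟩
  rintro ⟨u, r⟩ hp
  have hpC : (u, r) ∈ C := ConvexCone.subset_hull hp
  have hu : V.starProjection u = u := Submodule.starProjection_eq_self_iff.2 ⟨r, hpC⟩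
  have h1 : 0 ≤ G (u, r) := hG2 _ ((hS u r).2 (by rw [hu]; exact hpC))
  have h2 : G (u, r) = ell u + r := by
    have : ((u, r) : Y × ℝ) = (u, 0) + (0, r) := by simp
    rw [this, map_add, hGr]; rfl
  rw [inner_neg_left, InnerProductSpace.toDual_symm_apply]
  have h3 : ell.toContinuousLinearMap u = ell u := rfl
  rw [h3]
  change -(ell u) ≤ r
  linarith

variable [FiniteDimensional ℝ X] {g : X → EReal} {f : Y → EReal} {K : X →ₗ[ℝ] Y}

/-- The optimality conditions characterizing a saddle point. -/
structure IsOptimalPair (g : X → EReal) (f : Y → EReal) (K : X →ₗ[ℝ] Y) (xb : X) (yb : Y) :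
    Prop where
  left_ne_top : g xb ≠ ⊤
  right_ne_top : conj f yb ≠ ⊤
  left_mem : -(LinearMap.adjoint K yb) ∈ subdiff g xb
  right_mem : K xb ∈ subdiff (conj f) yb

theorem inner_neg_adjoint_sub (K : X →ₗ[ℝ] Y) (x x' : X) (y : Y) :
    inner ℝ (-(LinearMap.adjoint K y)) (x - x') = inner ℝ (K x') y - inner ℝ (K x) y := by
  rw [inner_neg_left, LinearMap.adjoint_inner_left, map_sub, inner_sub_right,
    real_inner_comm, real_inner_comm (K x')]
  ring

theorem IsOptimalPair.isSaddlePoint (hg : ClosedProperConvex g) (hf : ClosedProperConvex f)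
    {xb : X} {yb : Y} (h : IsOptimalPair g f K xb yb) : IsSaddlePoint g f K xb yb := by
  obtain ⟨a, ha⟩ := exists_coe_eq h.left_ne_top (hg.ne_bot xb)
  obtain ⟨c, hc⟩ := exists_coe_eq h.right_ne_top (hf.conj_ne_bot yb)
  intro x y
  constructor
  · by_cases hy : conj f y = ⊤
    · rw [lagrangian, hy, EReal.sub_top]; exact bot_le
    · obtain ⟨d, hd⟩ := exists_coe_eq hy (hf.conj_ne_bot y)
      rw [lagrangian_coe ha hc, lagrangian_coe ha hd]
      have := subdiff_le h.right_mem hc hd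
      rw [inner_sub_right] at this
      norm_cast
      linarith
  · by_cases hx : g x = ⊤
    · have : lagrangian g f K x yb = ⊤ := by
        rw [lagrangian, hx, hc, EReal.top_add_coe, EReal.top_sub_coe]
      rw [this]; exact le_top
    · obtain ⟨b, hb⟩ := exists_coe_eq hx (hg.ne_bot x)
      rw [lagrangian_coe ha hc, lagrangian_coe hb hc]
      have := subdiff_le h.left_mem ha hb
      rw [inner_neg_adjoint_sub] at this
      norm_cast
      linarith

/-- Testing the saddle inequalities at one point where `g` and `conj f` are finite excludes infinite
values at the saddle point; the two inequalities are then the two subgradient conditions. -/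
theorem IsSaddlePoint.isOptimalPair (hg : ClosedProperConvex g) (hf : ClosedProperConvex f)
    (hd : (dom (conj f)).Nonempty) {xb : X} {yb : Y} (h : IsSaddlePoint g f K xb yb) :
    IsOptimalPair g f K xb yb := by
  obtain ⟨x₁, hx₁⟩ := hg.dom_nonempty
  obtain ⟨y₁, hy₁⟩ := hd
  obtain ⟨b, hb⟩ := exists_coe_eq (ne_of_lt hx₁) (hg.ne_bot x₁)
  obtain ⟨d, hd⟩ := exists_coe_eq (ne_of_lt hy₁) (hf.conj_ne_bot y₁)
  have hright : conj f yb ≠ ⊤ := by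
    intro hyb
    have h1 := (h x₁ y₁).1
    rw [lagrangian, lagrangian, hyb, EReal.sub_top, le_bot_iff, hd, sub_eq_add_neg,
      EReal.add_eq_bot_iff, EReal.add_eq_bot_iff] at h1
    rcases h1 with (h1 | h1) | h1
    · exact hg.ne_bot _ h1
    · exact EReal.coe_ne_bot _ h1
    · exact EReal.coe_ne_bot (-d) (by exact_mod_cast h1)
  obtain ⟨c, hc⟩ := exists_coe_eq hright (hf.conj_ne_bot yb)
  have hleft : g xb ≠ ⊤ := by
    intro hxb
    have h1 := (h x₁ y₁).2
    rw [lagrangian_coe hb hc, lagrangian, hxb, hc, EReal.top_add_coe, EReal.top_sub_coe,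
      top_le_iff] at h1
    exact EReal.coe_ne_top _ h1
  obtain ⟨a, ha⟩ := exists_coe_eq hleft (hg.ne_bot xb)
  refine ⟨hleft, hright, ?_, ?_⟩
  · refine mem_subdiff_of_forall_real hg.ne_bot ha fun x b hb => ?_
    have h1 := (h x y₁).2
    rw [lagrangian_coe ha hc, lagrangian_coe hb hc] at h1
    norm_cast at h1
    rw [inner_neg_adjoint_sub]
    linarith
  · refine mem_subdiff_of_forall_real hf.conj_ne_bot hc fun y d hd => ?_
    have h1 := (h x₁ y).1
    rw [lagrangian_coe ha hc, lagrangian_coe ha hd] at h1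
    norm_cast at h1
    rw [inner_sub_right]
    linarith

/-- Two optimal pairs have the same primal component if `g` is strongly convex. -/
theorem IsOptimalPair.left_unique (hg : ClosedProperConvex g) (hf : ClosedProperConvex f)
    {γ : ℝ} (hγ : 0 < γ) (hgγ : StronglyConvex γ g) {x₁ x₂ : X} {y₁ y₂ : Y}
    (h₁ : IsOptimalPair g f K x₁ y₁) (h₂ : IsOptimalPair g f K x₂ y₂) : x₁ = x₂ := by
  obtain ⟨a₁, ha₁⟩ := exists_coe_eq h₁.left_ne_top (hg.ne_bot _)
  obtain ⟨a₂, ha₂⟩ := exists_coe_eq h₂.left_ne_top (hg.ne_bot _)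
  obtain ⟨c₁, hc₁⟩ := exists_coe_eq h₁.right_ne_top (hf.conj_ne_bot _)
  obtain ⟨c₂, hc₂⟩ := exists_coe_eq h₂.right_ne_top (hf.conj_ne_bot _)
  -- In the sum of the four inequalities all function values and pairings cancel; only the strong
  -- convexity term survives.
  have i1 := hgγ.le h₁.left_mem ha₁ ha₂
  have i2 := subdiff_le h₂.left_mem ha₂ ha₁
  have i3 := subdiff_le h₁.right_mem hc₁ hc₂
  have i4 := subdiff_le h₂.right_mem hc₂ hc₁
  rw [inner_neg_adjoint_sub] at i1 i2
  rw [inner_sub_right] at i3 i4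
  have h0 : γ / 2 * ‖x₂ - x₁‖ ^ 2 ≤ 0 := by linarith
  have h1 : ‖x₂ - x₁‖ ^ 2 ≤ 0 := by
    by_contra hlt
    push Not at hlt
    have : 0 < γ / 2 * ‖x₂ - x₁‖ ^ 2 := by positivity
    linarith
  have h2 : ‖x₂ - x₁‖ = 0 := by nlinarith [norm_nonneg (x₂ - x₁)]
  exact (sub_eq_zero.1 (norm_eq_zero.1 h2)).symm

/-- Strong duality under the relative interior condition. -/
theorem IsPrimalSolution.exists_isOptimalPair (hg : ClosedProperConvex g)
    (hf : ClosedProperConvex f)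
    (hri : ∃ x ∈ intrinsicInterior ℝ (dom g), K x ∈ intrinsicInterior ℝ (dom f)) {xs : X}
    (hxs : IsPrimalSolution g f K xs) : ∃ ys, IsOptimalPair g f K xs ys := by
  obtain ⟨xt, hxt, hKxt⟩ := hri
  have hgt : g xt < ⊤ := (intrinsicInterior_subset hxt : xt ∈ dom g)
  have hft : f (K xt) < ⊤ := (intrinsicInterior_subset hKxt : K xt ∈ dom f)
  have hlt : g xs + f (K xs) ≠ ⊤ :=
    ((hxs xt).trans_lt (EReal.add_lt_top (ne_of_lt hgt) (ne_of_lt hft))).ne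
  rw [EReal.add_ne_top_iff_ne_top₂ (hg.ne_bot _) (hf.ne_bot _)] at hlt
  obtain ⟨a, ha⟩ := exists_coe_eq hlt.1 (hg.ne_bot _)
  obtain ⟨b, hb⟩ := exists_coe_eq hlt.2 (hf.ne_bot _)
  -- `A` plays the role of the epigraph of the perturbed value `u ↦ inf_x g(x) + f(Kx + u)`, lowered
  -- by the optimal value.
  set A : Set (Y × ℝ) := {p | ∃ x w, ∃ s t : ℝ, g x ≤ s ∧ f w ≤ t ∧ p = (w - K x, s + t - (a + b))}
    with hA
  have hconv : Convex ℝ A := by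
    rintro _ ⟨x, w, s, t, hs, ht, rfl⟩ _ ⟨x', w', s', t', hs', ht', rfl⟩ c d hc hd hcd
    refine ⟨c • x + d • x', c • w + d • w', c * s + d * s', c * t + d * t',
      hg.le_combo hs hs' hc hd hcd, hf.le_combo ht ht' hc hd hcd, ?_⟩
    simp only [Prod.smul_mk, Prod.mk_add_mk, smul_eq_mul, map_add, map_smul, Prod.mk.injEq]
    constructor
    · module
    · linear_combination (-(a + b)) * hcd
  obtain ⟨ys, hys⟩ := exists_inner_le_of_convex hconv
    ⟨xs, K xs, a, b, ha.le, hb.le, by simp⟩ (by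
      rintro r ⟨x, w, s, t, hs, ht, he⟩
      obtain ⟨h1, h2⟩ := Prod.mk.inj he
      rw [eq_comm, sub_eq_zero] at h1
      subst h1
      have h3 := (hxs x).trans (add_le_add hs ht)
      rw [ha, hb] at h3
      norm_cast at h3
      linarith) (by
      rintro _ ⟨x, w, s, t, hs, ht, rfl⟩
      -- Moving from `xt` away from `x` and from `K xt` away from `w` by the same factor `e` turns
      -- the perturbation `w - K x` into `-e (w - K x)`.
      obtain ⟨e, ⟨he1, he2⟩, he⟩ := (((eventually_sub_smul_mem hxt
        (y := x) (hs.trans_lt (EReal.coe_lt_top _))).and (eventually_sub_smul_mem hKxt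
        (y := w) (ht.trans_lt (EReal.coe_lt_top _)))).and self_mem_nhdsWithin).exists
      obtain ⟨s', hs'⟩ := exists_coe_eq (ne_of_lt he1) (hg.ne_bot _)
      obtain ⟨t', ht'⟩ := exists_coe_eq (ne_of_lt he2) (hf.ne_bot _)
      refine ⟨e, he, s' + t' - (a + b), _, _, s', t', hs'.le, ht'.le, ?_⟩
      simp only [map_sub, map_smul, Prod.mk.injEq, and_true]
      module)
  have key : ∀ x w (s t : ℝ), g x = s → f w = t →
      inner ℝ ys w - inner ℝ ys (K x) ≤ s + t - (a + b) := by
    intro x w s t hs ht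
    rw [← inner_sub_right]
    exact hys _ ⟨x, w, s, t, hs.le, ht.le, rfl⟩
  have hle : conj f ys ≤ ((inner ℝ ys (K xs) - b : ℝ) : EReal) := by
    rw [conj_le hf.ne_bot]
    intro w t ht
    have := key xs w a t ha ht
    linarith
  have heq : conj f ys = ((inner ℝ ys (K xs) - b : ℝ) : EReal) :=
    le_antisymm hle (conj_ge f ys _ hb)
  refine ⟨ys, hlt.1, by rw [heq]; exact EReal.coe_ne_top _, ?_, ?_⟩
  · refine mem_subdiff_of_forall_real hg.ne_bot ha fun x s hs => ?_
    have := key x (K xs) s b hs hb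
    rw [inner_neg_adjoint_sub, real_inner_comm, real_inner_comm ys (K x)]
    linarith
  · refine mem_subdiff_of_forall_real hf.conj_ne_bot heq fun y d hd => ?_
    have := conj_ge f y _ hb
    rw [hd] at this
    norm_cast at this
    rw [inner_sub_right]
    linarith [real_inner_comm ys (K xs), real_inner_comm y (K xs)]

end Duality

end GRPDA

namespace GRPDA

/-! ### Linear growth from a reflection principle. -/

section Growth

/-- A sequence that increases by at least `p` or jumps above `-a n`, and increases by at most `q`,
is nonnegative so often that a companion sequence gaining `C` at these times grows linearly. -/
theorem linear_growth_of_reflection {a r : ℕ → ℝ} {p q C r₀ : ℝ} (hp : 0 < p) (hq : 0 ≤ q)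
    (hC : 0 < C) (hr₀ : 0 < r₀) (ha : ∀ n, a (n + 1) ≤ a n + q)
    (ha' : ∀ n, a n + p ≤ a (n + 1) ∨ -a n ≤ a (n + 1)) (hr : ∀ n, r₀ ≤ r n)
    (hmono : ∀ n, r n ≤ r (n + 1)) (hgain : ∀ n, 0 ≤ a n → r n + C ≤ r (n + 1)) :
    (∃ c > 0, ∀ n : ℕ, 1 ≤ n → c * n ≤ r n) ∧ ∃ᶠ n in atTop, 0 ≤ a n := by
  -- The potential drops by `p` whenever the new `a` is negative: either `a` climbs by `p`, or it is
  -- reflected from a nonnegative value, where the extra `p` was stored.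
  set V : ℕ → ℝ := fun n => if 0 ≤ a n then a n + p else -a n with hV
  have hV0 : ∀ n, 0 ≤ V n := by
    intro n
    simp only [hV]
    split_ifs <;> linarith
  have hbad : ∀ n, a (n + 1) < 0 → V (n + 1) ≤ V n - p := by
    intro n hn
    simp only [hV, if_neg (not_le.2 hn)]
    split_ifs <;> rcases ha' n with h | h <;> linarith
  have hgood : ∀ n, V (n + 1) ≤ V n - p + (q + 2 * p) := by
    intro n
    simp only [hV]
    have := ha n
    split_ifs <;> rcases ha' n with h | h <;> linarith
  constructor
  · set M := (q + 2 * p) / C with hM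
    have hMC : M * C = q + 2 * p := by rw [hM]; field_simp
    have hM0 : 0 ≤ M := by positivity
    have key : ∀ n : ℕ, M * r 1 - V 0 + p * n ≤ M * r (n + 1) - V n := by
      intro n
      induction n with
      | zero => simp
      | succ n ih =>
        push_cast
        by_cases h : 0 ≤ a (n + 1)
        · have h1 := mul_le_mul_of_nonneg_left (hgain (n + 1) h) hM0
          have h2 := hgood n
          rw [mul_add] at h1
          linarith
        · have h1 := mul_le_mul_of_nonneg_left (hmono (n + 1)) hM0
          have h2 := hbad n (not_le.1 h)
          linarith
    have hQ : 0 < M + (V 0 + p) / r₀ := by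
      have := hV0 0
      positivity
    refine ⟨p / (M + (V 0 + p) / r₀), by positivity, fun n hn => ?_⟩
    obtain ⟨m, rfl⟩ := Nat.exists_eq_add_of_le' hn
    rw [div_mul_eq_mul_div, div_le_iff₀ hQ]
    have h1 := key m
    have h2 : 0 ≤ M * r 1 := mul_nonneg hM0 (hr₀.le.trans (hr 1))
    have h3 : V 0 + p ≤ r (m + 1) * ((V 0 + p) / r₀) := by
      calc V 0 + p = r₀ * ((V 0 + p) / r₀) := by field_simp
        _ ≤ _ := mul_le_mul_of_nonneg_right (hr _) (div_nonneg (by linarith [hV0 0]) hr₀.le)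
    push_cast
    linarith [hV0 m]
  · intro h
    obtain ⟨N, hN⟩ := eventually_atTop.1 h
    have key : ∀ k : ℕ, V (N + k) ≤ V N - p * k := by
      intro k
      induction k with
      | zero => simp
      | succ k ih =>
        have := hbad (N + k) (not_le.1 (hN _ (by omega)))
        push_cast
        rw [← add_assoc]
        linarith
    obtain ⟨k, hk⟩ := exists_nat_gt (V N / p)
    rw [div_lt_iff₀ hp] at hk
    linarith [key k, hV0 (N + k)]

/-- With `m` the minimum, `m ≤ √b` gives `(√b + m) ^ 2 ≤ b + 3 m √b`, and `m ≤ D / 4` finishes. -/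
theorem add_le_sqrt_of_le_add {b b' r₀ D : ℝ} (hr₀ : 0 < r₀) (hD : 0 < D) (hb : r₀ ≤ √b)
    (hb' : b + D * √b ≤ b') : √b + min (D / 4) r₀ ≤ √b' := by
  have hb0 : 0 < b := Real.sqrt_pos.1 (hr₀.trans_le hb)
  refine Real.le_sqrt_of_sq_le (le_trans ?_ hb')
  have h1 := min_le_left (D / 4) r₀
  have h2 := min_le_right (D / 4) r₀
  have h3 : 0 < min (D / 4) r₀ := lt_min (by positivity) hr₀
  have h4 := Real.sq_sqrt hb0.le
  nlinarith [mul_le_mul_of_nonneg_left h1 h3.le, mul_le_mul_of_nonneg_right h1 (hr₀.le.trans hb),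
    mul_le_mul_of_nonneg_left (h2.trans hb) h3.le]

end Growth

/-! ### Consequences of the admissible range of `ψ`. -/

section StepFactor

theorem one_lt_of_cubic {ψ₀ : ℝ} (h : ψ₀ ^ 3 - ψ₀ - 1 = 0) : 1 < ψ₀ := by
  by_contra hle
  push Not at hle
  rcases le_total 0 ψ₀ with h0 | h0
  · nlinarith [mul_nonneg h0 (sub_nonneg.2 hle), mul_nonneg (mul_nonneg h0 h0) (sub_nonneg.2 hle)]
  · nlinarith [sq_nonneg (ψ₀ + 1), sq_nonneg (ψ₀ ^ 2 - ψ₀), mul_nonneg (neg_nonneg.2 h0)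
      (sq_nonneg (ψ₀ + 1 / 2)), mul_nonneg (neg_nonneg.2 h0) (sq_nonneg (ψ₀ + 1))]

theorem stepFactor_mul_sq {ψ : ℝ} (h : 0 < ψ) : stepFactor ψ * ψ ^ 2 = 1 + ψ := by
  rw [stepFactor]; field_simp

theorem one_lt_stepFactor {ψ : ℝ} (h : 1 < ψ) (h' : ψ < Real.goldenRatio) :
    1 < stepFactor ψ := by
  rw [stepFactor, lt_div_iff₀ (by positivity)]
  have h1 := Real.goldenRatio_sq
  nlinarith

theorem stepFactor_lt {ψ₀ ψ : ℝ} (hψ₀ : ψ₀ ^ 3 - ψ₀ - 1 = 0) (h : ψ₀ < ψ) : stepFactor ψ < ψ := by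
  have h1 := one_lt_of_cubic hψ₀
  have h2 : 0 < ψ := by linarith
  rw [stepFactor, div_lt_iff₀ (by positivity)]
  have h3 : 0 < (ψ - ψ₀) * (ψ ^ 2 + ψ * ψ₀ + ψ₀ ^ 2 - 1) :=
    mul_pos (by linarith) (by nlinarith)
  nlinarith

end StepFactor

/-! ### Stepsizes and growth of the weights. -/

section Run

variable {X Y : Type*} [NormedAddCommGroup X] [InnerProductSpace ℝ X] [FiniteDimensional ℝ X]
  [NormedAddCommGroup Y] [InnerProductSpace ℝ Y] [FiniteDimensional ℝ Y]
  {g : X → EReal} {f : Y → EReal} {K : X →ₗ[ℝ] Y} {γ ψ μ : ℝ}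
  {z x : ℕ → X} {y : ℕ → Y} {ω β τ : ℕ → ℝ}

/-- A rejected trial stepsize is bounded below. -/
theorem lt_mul_of_not_accepts {K : X →ₗ[ℝ] Y} {L b s t : ℝ} {u v : Y} (hb : 0 < b) (hs : 0 < s)
    (ht : 0 < t) (hψ : 0 < ψ) (hK : ∀ w, ‖LinearMap.adjoint K w‖ ≤ L * ‖w‖)
    (h : ¬ Accepts K ψ b s t u v) : ψ < b * t * s * L ^ 2 := by
  rw [Accepts, not_le, ← map_sub] at h
  have h1 : √(ψ / s) * ‖v - u‖ < √(b * t) * L * ‖v - u‖ := by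
    rw [mul_assoc]
    exact h.trans_le (mul_le_mul_of_nonneg_left (hK _) (Real.sqrt_nonneg _))
  have h2 := lt_of_mul_lt_mul_right h1 (norm_nonneg _)
  have h3 := pow_lt_pow_left₀ h2 (Real.sqrt_nonneg _) two_ne_zero
  rw [mul_pow, Real.sq_sqrt (by positivity), Real.sq_sqrt (by positivity), div_lt_iff₀ hs] at h3
  linarith

/-- The parameter ranges used in the analysis. -/
structure ValidParams (γ ψ μ : ℝ) : Prop where
  gamma_pos : 0 < γ
  one_lt : 1 < ψ
  one_lt_factor : 1 < stepFactor ψ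
  factor_lt : stepFactor ψ < ψ
  mu_pos : 0 < μ
  mu_lt_one : μ < 1

theorem IsAcceleratedRun.tau_beta_pos (hrun : IsAcceleratedRun g f K γ ψ μ z x y ω β τ)
    (hp : ValidParams γ ψ μ) (n : ℕ) : 0 < τ n ∧ 0 < β n := by
  obtain ⟨hγ, hψ, hφ, hφψ, hμ, hμ'⟩ := hp
  induction n with
  | zero => exact ⟨hrun.tau_pos, hrun.beta_pos⟩
  | succ n ih =>
    obtain ⟨hτ, hβ⟩ := ih
    constructor
    · obtain ⟨i, hi, -⟩ := hrun.y_step n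
      rw [hi]; positivity
    · rw [hrun.beta_step, hrun.omega_step]
      have : 0 < ψ - stepFactor ψ := by linarith
      positivity

/-- This identity is the purpose of the rule for `ω`: the right side is the weight produced by one
energy estimate, and the left side dominates the next weight because `τ (n + 1) ≤ φ τ n`. -/
theorem IsAcceleratedRun.beta_succ_mul (hrun : IsAcceleratedRun g f K γ ψ μ z x y ω β τ)
    (hp : ValidParams γ ψ μ) (n : ℕ) :
    β (n + 1) * (ψ + stepFactor ψ * γ * τ n) = β n * (ψ * (1 + γ * τ n)) := by
  obtain ⟨hτ, hβ⟩ := hrun.tau_beta_pos hp n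
  obtain ⟨hγ, hψ, hφ, hφψ, hμ, hμ'⟩ := hp
  have : 0 < ψ + stepFactor ψ * γ * τ n := by positivity
  rw [hrun.beta_step, hrun.omega_step]
  field_simp
  ring

theorem IsAcceleratedRun.le_beta_succ (hrun : IsAcceleratedRun g f K γ ψ μ z x y ω β τ)
    (hp : ValidParams γ ψ μ) (n : ℕ) : β n ≤ β (n + 1) := by
  have h := hrun.beta_succ_mul hp n
  obtain ⟨hτ, hβ⟩ := hrun.tau_beta_pos hp n
  obtain ⟨hγ, hψ, hφ, hφψ, hμ, hμ'⟩ := hp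
  have h0 : 0 < ψ + stepFactor ψ * γ * τ n := by positivity
  refine le_of_mul_le_mul_right (h.symm ▸ mul_le_mul_of_nonneg_left ?_ hβ.le) h0
  nlinarith [mul_pos hγ hτ]

theorem IsAcceleratedRun.beta_succ_le (hrun : IsAcceleratedRun g f K γ ψ μ z x y ω β τ)
    (hp : ValidParams γ ψ μ) (n : ℕ) : stepFactor ψ * β (n + 1) ≤ ψ * β n := by
  have h := hrun.beta_succ_mul hp n
  obtain ⟨hτ, hβ⟩ := hrun.tau_beta_pos hp n
  obtain ⟨hγ, hψ, hφ, hφψ, hμ, hμ'⟩ := hp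
  have h0 : 0 < ψ + stepFactor ψ * γ * τ n := by positivity
  refine le_of_mul_le_mul_right ?_ h0
  have h1 : 0 < β n * ψ := by positivity
  calc stepFactor ψ * β (n + 1) * (ψ + stepFactor ψ * γ * τ n)
      = β n * ψ * (stepFactor ψ * (1 + γ * τ n)) := by linear_combination stepFactor ψ * h
    _ ≤ β n * ψ * (ψ + stepFactor ψ * γ * τ n) := by
        refine mul_le_mul_of_nonneg_left ?_ h1.le
        nlinarith
    _ = _ := by ring

theorem IsAcceleratedRun.tau_succ_le (hrun : IsAcceleratedRun g f K γ ψ μ z x y ω β τ)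
    (hp : ValidParams γ ψ μ) (n : ℕ) : τ (n + 1) ≤ stepFactor ψ * τ n := by
  obtain ⟨hτ, hβ⟩ := hrun.tau_beta_pos hp n
  obtain ⟨hγ, hψ, hφ, hφψ, hμ, hμ'⟩ := hp
  obtain ⟨i, hi, -⟩ := hrun.y_step n
  rw [hi]
  exact mul_le_of_le_one_right (by positivity) (pow_le_one₀ hμ.le hμ'.le)

/-- Either the first trial stepsize is accepted, or the product of consecutive stepsizes is bounded
below relative to `β`. -/
theorem IsAcceleratedRun.exists_tau_dichotomy (hrun : IsAcceleratedRun g f K γ ψ μ z x y ω β τ)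
    (hp : ValidParams γ ψ μ) (hf : ClosedProperConvex f) : ∃ c > 0, ∀ n,
      τ (n + 1) = stepFactor ψ * τ n ∨
      (τ (n + 1) ≤ μ * (stepFactor ψ * τ n) ∧ c ≤ β (n + 1) * τ (n + 1) * τ n) := by
  set T := LinearMap.toContinuousLinearMap (LinearMap.adjoint K)
  have hT : ∀ w, ‖LinearMap.adjoint K w‖ ≤ ‖T‖ * ‖w‖ := fun w => T.le_opNorm w
  have hpos := hrun.tau_beta_pos hp
  obtain ⟨hγ, hψ, hφ, hφψ, hμ, hμ'⟩ := hp
  refine ⟨μ * ψ / (‖T‖ ^ 2 + 1), by positivity, fun n => ?_⟩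
  obtain ⟨hτ, -⟩ := hpos n
  obtain ⟨hτ', hβ⟩ := hpos (n + 1)
  obtain ⟨i, hi, -, -, hrej⟩ := hrun.y_step n
  rcases Nat.eq_zero_or_pos i with rfl | hi0
  · left; simpa using hi
  · right
    -- Trial `j = i - 1` was rejected, and its stepsize is the accepted one divided by `μ`.
    obtain ⟨j, rfl⟩ := Nat.exists_eq_add_of_le' hi0
    have hi' : τ (n + 1) = μ * (stepFactor ψ * τ n * μ ^ j) := by rw [hi]; ring
    constructor
    · rw [hi']
      exact mul_le_mul_of_nonneg_left
        (mul_le_of_le_one_right (by positivity) (pow_le_one₀ hμ.le hμ'.le)) hμ.le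
    · have ht : 0 < stepFactor ψ * τ n * μ ^ j := by positivity
      obtain ⟨v, hv⟩ := hf.exists_isProx_conj (mul_pos hβ ht)
        (y n + (β (n + 1) * (stepFactor ψ * τ n * μ ^ j)) • K (x (n + 1)))
      have h1 := lt_mul_of_not_accepts hβ hτ ht (by linarith) hT (hrej j (by omega) v hv)
      rw [div_le_iff₀ (by positivity), hi']
      have h2 : 0 < β (n + 1) * (stepFactor ψ * τ n * μ ^ j) * τ n := by positivity
      nlinarith

/-- The increment of `β` equals `√β` times `γ (ψ - φ) √β τ / (ψ + φ γ τ)`. This factor increases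
with `τ`; inserting `τ ≥ κ / √β` and `√β ≥ √(β 0)` bounds it below by `D`. -/
theorem IsAcceleratedRun.beta_gain (hrun : IsAcceleratedRun g f K γ ψ μ z x y ω β τ)
    (hp : ValidParams γ ψ μ) {κ : ℝ} (hκ : 0 < κ) : ∃ C > 0, ∀ n, κ ≤ √(β n) * τ n →
      √(β n) + C ≤ √(β (n + 1)) := by
  have hpos := hrun.tau_beta_pos hp
  have hmul := hrun.beta_succ_mul hp
  have hmono : Monotone β := monotone_nat_of_le_succ (hrun.le_beta_succ hp)
  obtain ⟨hγ, hψ, hφ, hφψ, hμ, hμ'⟩ := hp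
  set φ := stepFactor ψ
  set r₀ := √(β 0) with hr₀
  have hr₀p : 0 < r₀ := Real.sqrt_pos.2 (hpos 0).2
  have hd : 0 < ψ - φ := by linarith
  set D := γ * (ψ - φ) * κ * r₀ / (ψ * r₀ + φ * γ * κ) with hD
  have hDp : 0 < D := by positivity
  refine ⟨min (D / 4) r₀, lt_min (by positivity) hr₀p, fun n hn => ?_⟩
  obtain ⟨hτ, hβ⟩ := hpos n
  have hr : r₀ ≤ √(β n) := Real.sqrt_le_sqrt (hmono n.zero_le)
  refine add_le_sqrt_of_le_add hr₀p hDp hr ?_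
  set r := √(β n)
  have hrp : 0 < r := hr₀p.trans_le hr
  have hr2 : β n = r ^ 2 := (Real.sq_sqrt hβ.le).symm
  have h0 : 0 < ψ + φ * γ * τ n := by positivity
  have hstep : β (n + 1) = β n + β n * (γ * (ψ - φ) * τ n) / (ψ + φ * γ * τ n) := by
    rw [eq_comm, ← sub_eq_zero]
    field_simp
    linear_combination - hmul n
  rw [hstep]
  refine add_le_add le_rfl ?_
  rw [hr2, hD, div_mul_eq_mul_div, div_le_div_iff₀ (by positivity) h0]
  have h1 : κ * r₀ * (ψ + φ * γ * τ n) ≤ r * τ n * (ψ * r₀ + φ * γ * κ) := by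
    have e1 : κ * (r₀ * ψ) ≤ r * τ n * (r₀ * ψ) := mul_le_mul_of_nonneg_right hn (by positivity)
    have e2 : r₀ * (κ * φ * γ * τ n) ≤ r * (κ * φ * γ * τ n) :=
      mul_le_mul_of_nonneg_right hr (by positivity)
    linarith
  have h2 := mul_le_mul_of_nonneg_left h1 (show 0 ≤ γ * (ψ - φ) * r by positivity)
  linarith

/-- Growth of `β` and lower bounds for the stepsizes at infinitely many indices. -/
theorem IsAcceleratedRun.growth (hrun : IsAcceleratedRun g f K γ ψ μ z x y ω β τ)
    (hp : ValidParams γ ψ μ) (hf : ClosedProperConvex f) :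
    (∃ c > 0, ∀ n : ℕ, 1 ≤ n → c * n ≤ √(β n)) ∧
      ∃ κ > 0, ∃ᶠ n in atTop, κ ≤ √(β n) * τ n := by
  obtain ⟨c, hc, hdich⟩ := hrun.exists_tau_dichotomy hp hf
  have hpos := hrun.tau_beta_pos hp
  have hle := hrun.beta_succ_le hp
  have hge := hrun.le_beta_succ hp
  have hτle := hrun.tau_succ_le hp
  have hgain := fun κ hκ => hrun.beta_gain hp (κ := κ) hκ
  obtain ⟨hγ, hψ, hφ, hφψ, hμ, hμ'⟩ := hp
  set φ := stepFactor ψ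
  set l := (Real.log ψ - Real.log φ) / 2 with hl
  have hlp : 0 ≤ l := by
    have := Real.log_le_log (by linarith) hφψ.le
    rw [hl]; linarith
  -- The shift is chosen so that the rejection bound reads `a n + a (n + 1) ≥ 0`; `l` pays for
  -- replacing half of `log (β (n + 1))` by half of `log (β n)`.
  set c₀ := (Real.log c - l) / 2 with hc₀
  have hlogβ : ∀ n, Real.log (β n) ≤ Real.log (β (n + 1)) ∧
      Real.log (β (n + 1)) ≤ Real.log (β n) + 2 * l := by
    intro n
    constructor
    · exact Real.log_le_log (hpos n).2 (hge n)
    · have := Real.log_le_log (mul_pos (by linarith) (hpos (n + 1)).2) (hle n)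
      rw [Real.log_mul (by linarith) (hpos _).2.ne', Real.log_mul (by linarith) (hpos _).2.ne']
        at this
      rw [hl]; linarith
  have hlogτ : ∀ n, Real.log (τ (n + 1)) ≤ Real.log φ + Real.log (τ n) := by
    intro n
    have := Real.log_le_log (hpos (n + 1)).1 (hτle n)
    rwa [Real.log_mul (by linarith) (hpos _).1.ne'] at this
  have hiff : ∀ n, 0 ≤ Real.log (β n) / 2 + Real.log (τ n) - c₀ ↔ Real.exp c₀ ≤ √(β n) * τ n := by
    intro n
    rw [← Real.le_log_iff_exp_le (mul_pos (Real.sqrt_pos.2 (hpos n).2) (hpos n).1),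
      Real.log_mul (Real.sqrt_pos.2 (hpos n).2).ne' (hpos n).1.ne', Real.log_sqrt (hpos n).2.le,
      sub_nonneg]
  obtain ⟨C, hC, hCg⟩ := hgain (Real.exp c₀) (Real.exp_pos _)
  have hmono : Monotone β := monotone_nat_of_le_succ hge
  obtain ⟨h1, h2⟩ := linear_growth_of_reflection
    (a := fun n => Real.log (β n) / 2 + Real.log (τ n) - c₀) (r := fun n => √(β n))
    (p := Real.log φ) (q := Real.log φ + l) (C := C) (r₀ := √(β 0))
    (Real.log_pos hφ) (add_nonneg (Real.log_pos hφ).le hlp) hC (Real.sqrt_pos.2 (hpos 0).2)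
    (fun n => by linarith [hlogβ n, hlogτ n]) (fun n => by
      rcases hdich n with h | ⟨-, h⟩
      · left
        rw [h, Real.log_mul (by linarith) (hpos _).1.ne']
        linarith [(hlogβ n).1]
      · right
        have h3 := Real.log_le_log hc h
        rw [Real.log_mul (mul_pos (hpos _).2 (hpos _).1).ne' (hpos _).1.ne',
          Real.log_mul (hpos _).2.ne' (hpos _).1.ne'] at h3
        linarith [(hlogβ n).2])
    (fun n => Real.sqrt_le_sqrt (hmono n.zero_le)) (fun n => Real.sqrt_le_sqrt (hge n))
    (fun n hn => hCg n ((hiff n).1 hn))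
  exact ⟨h1, Real.exp c₀, Real.exp_pos _, h2.mono fun n hn => (hiff n).1 hn⟩

/-- The total weight grows quadratically. -/
theorem IsAcceleratedRun.totalWeight_ge (hrun : IsAcceleratedRun g f K γ ψ μ z x y ω β τ)
    (hp : ValidParams γ ψ μ) (hf : ClosedProperConvex f) :
    ∃ c > 0, ∀ N : ℕ, 1 ≤ N → c * (N : ℝ) ^ 2 ≤ totalWeight β τ N := by
  obtain ⟨⟨c, hc, hcβ⟩, -⟩ := hrun.growth hp hf
  have hpos := hrun.tau_beta_pos hp
  have hmul := hrun.beta_succ_mul hp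
  obtain ⟨hγ, hψ, hφ, hφψ, hμ, hμ'⟩ := hp
  set φ := stepFactor ψ
  have hw : ∀ N, 0 ≤ totalWeight β τ N := fun N =>
    Finset.sum_nonneg fun n _ => (mul_pos (hpos n).2 (hpos n).1).le
  have hsucc : ∀ N, totalWeight β τ (N + 1) = totalWeight β τ N + β (N + 1) * τ (N + 1) := by
    intro N
    rw [totalWeight, Finset.sum_Icc_succ_top (by omega)]; rfl
  have hincr : ∀ n, β (n + 1) ≤ β n + γ * (β n * τ n) * ψ := by
    intro n
    obtain ⟨hτ, hβ⟩ := hpos n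
    have h0 : 0 < ψ + φ * γ * τ n := by positivity
    refine le_of_mul_le_mul_right ?_ h0
    rw [hmul n]
    have : 0 ≤ β n * (φ * γ * τ n) + γ * (β n * τ n) * ψ * (φ * γ * τ n) +
        β n * γ * τ n * ψ * (ψ - 1) := by
      have : 0 < ψ - 1 := by linarith
      positivity
    nlinarith
  -- Telescoping bounds `β` by the total weight, so the quadratic growth of `β` passes to the
  -- weight.
  have hle : ∀ N, β (N + 1) ≤ β 1 + γ * ψ * totalWeight β τ N := by
    intro N
    induction N with
    | zero => simp [totalWeight]
    | succ N ih =>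
      rw [hsucc]
      linarith [hincr (N + 1)]
  have hge : ∀ N : ℕ, c ^ 2 * (N : ℝ) ^ 2 ≤ β (N + 1) := by
    intro N
    have h1 := hcβ (N + 1) (by omega)
    have h2 : c * (N : ℝ) ≤ √(β (N + 1)) := by push_cast at h1; nlinarith
    have h3 := pow_le_pow_left₀ (by positivity) h2 2
    rwa [Real.sq_sqrt (hpos _).2.le, mul_pow] at h3
  have h1w : ∀ N, 1 ≤ N → β 1 * τ 1 ≤ totalWeight β τ N := fun N hN =>
    Finset.single_le_sum (f := fun n => β n * τ n) (fun n _ => (mul_pos (hpos n).2 (hpos n).1).le)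
      (Finset.mem_Icc.2 ⟨le_rfl, hN⟩)
  obtain ⟨hτ1, hβ1⟩ := hpos 1
  refine ⟨c ^ 2 / (1 / τ 1 + γ * ψ), by positivity, fun N hN => ?_⟩
  rw [div_mul_eq_mul_div, div_le_iff₀ (by positivity)]
  -- The initial `β 1` is absorbed through the first summand `β 1 * τ 1`.
  have h3 : β 1 ≤ totalWeight β τ N * (1 / τ 1) := by
    rw [mul_one_div, le_div_iff₀ hτ1]
    exact h1w N hN
  linarith [hge N, hle N]

end Run

end GRPDA

namespace GRPDA

/-! ### The one-step energy estimate. -/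

section Energy

variable {X Y : Type*} [NormedAddCommGroup X] [InnerProductSpace ℝ X]
  [NormedAddCommGroup Y] [InnerProductSpace ℝ Y]

theorem two_mul_inner_sub_sub (a b c : X) :
    2 * inner ℝ (a - b) (c - b) = ‖b - a‖ ^ 2 + ‖b - c‖ ^ 2 - ‖a - c‖ ^ 2 := by
  have h : a - c = (a - b) - (c - b) := by abel
  rw [h, norm_sub_sq_real (a - b), norm_sub_rev b a, norm_sub_rev b c]
  ring

theorem sq_mul_norm_combo_sub_sq {ψ : ℝ} (hψ : ψ ≠ 0) (x z w : X) :
    ψ ^ 2 * ‖((ψ - 1) / ψ) • x + (1 / ψ) • z - w‖ ^ 2 =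
      (ψ - 1) * ψ * ‖x - w‖ ^ 2 + ψ * ‖z - w‖ ^ 2 - (ψ - 1) * ‖x - z‖ ^ 2 := by
  have h1 : ((ψ - 1) / ψ) • x + (1 / ψ) • z - w =
      ((ψ - 1) / ψ) • (x - w) + (1 / ψ) • (z - w) := by
    have : w = ((ψ - 1) / ψ) • w + (1 / ψ) • w := by
      rw [← add_smul]
      have : (ψ - 1) / ψ + 1 / ψ = 1 := by field_simp; ring
      rw [this, one_smul]
    nth_rewrite 1 [this]
    module
  have h2 : x - z = (x - w) - (z - w) := by abel
  rw [h1, h2, norm_add_sq_real, norm_sub_sq_real (x - w), norm_smul, norm_smul, inner_smul_left,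
    inner_smul_right, mul_pow, mul_pow, Real.norm_eq_abs, Real.norm_eq_abs, sq_abs, sq_abs]
  simp only [conj_trivial]
  field_simp
  ring

theorem neg_le_of_sq_le {c e s w N : ℝ} (he : 0 < e) (h : c ^ 2 ≤ e * w) (hN : |N| ≤ c * s) :
    0 ≤ e * s ^ 2 + w + 2 * N := by
  have h1 : 0 ≤ e * (e * s ^ 2 + w - 2 * (c * s)) := by nlinarith [sq_nonneg (e * s - c)]
  have h2 := nonneg_of_mul_nonneg_right h1 he
  linarith [neg_abs_le N]

variable [FiniteDimensional ℝ X] [FiniteDimensional ℝ Y]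

/-- Multiply the three subgradient inequalities by `2 b t₁` and add. Polarization turns the inner
products into squared distances, and the combination defining `z₂` replaces `‖x₁ - xb‖ ^ 2` by `‖z₂
- xb‖ ^ 2`. -/
theorem energy_inequality {K : X →ₗ[ℝ] Y} {γ ψ b t₀ t₁ g₀ g₁ gb f₁ fb : ℝ}
    {xb x₀ x₁ z₀ z₁ z₂ : X} {yb y₀ y₁ : Y} (hγ : 0 < γ) (hψ : 1 < ψ) (hb : 0 < b) (ht₀ : 0 < t₀)
    (ht₁ : 0 < t₁) (hz₁ : z₁ = ((ψ - 1) / ψ) • x₀ + (1 / ψ) • z₀)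
    (hz₂ : z₂ = ((ψ - 1) / ψ) • x₁ + (1 / ψ) • z₁)
    (h₁ : g₁ + (inner ℝ ((1 / t₁) • (z₁ - t₁ • LinearMap.adjoint K y₁ - x₁)) (xb - x₁) +
      γ / 2 * ‖xb - x₁‖ ^ 2) ≤ gb)
    (h₂ : g₀ + (inner ℝ ((1 / t₀) • (z₀ - t₀ • LinearMap.adjoint K y₀ - x₀)) (x₁ - x₀) +
      γ / 2 * ‖x₁ - x₀‖ ^ 2) ≤ g₁)
    (h₃ : f₁ + inner ℝ ((1 / (b * t₁)) • (y₀ + (b * t₁) • K x₀ - y₁)) (yb - y₁) ≤ fb)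
    (hacc : Accepts K ψ b t₀ t₁ y₀ y₁) :
    b * (ψ * (1 + γ * t₁)) / (ψ - 1) * ‖z₂ - xb‖ ^ 2 + ‖y₁ - yb‖ ^ 2 +
      2 * (b * t₁) * (g₀ + inner ℝ (K x₀) yb - fb - (gb + inner ℝ (K xb) y₁ - f₁)) +
      b * (ψ * (stepFactor ψ - t₁ / t₀)) * ‖x₁ - z₁‖ ^ 2 + b * (ψ * (t₁ / t₀)) * ‖x₀ - z₁‖ ^ 2 ≤
    b * (ψ + γ * t₁) / (ψ - 1) * ‖z₁ - xb‖ ^ 2 + ‖y₀ - yb‖ ^ 2 := by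
  have hψ0 : ψ ≠ 0 := by linarith
  have hψ1 : 0 < ψ - 1 := by linarith
  set k₀ := LinearMap.adjoint K y₀ with hk₀
  set k₁ := LinearMap.adjoint K y₁ with hk₁
  have e₁ : inner ℝ ((1 / t₁) • (z₁ - t₁ • k₁ - x₁)) (xb - x₁) =
      1 / t₁ * inner ℝ (z₁ - x₁) (xb - x₁) - inner ℝ k₁ (xb - x₁) := by
    have : (1 / t₁) • (z₁ - t₁ • k₁ - x₁) = (1 / t₁) • (z₁ - x₁) - k₁ := by
      have : k₁ = (1 / t₁) • t₁ • k₁ := by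
        rw [smul_smul, one_div_mul_cancel ht₁.ne', one_smul]
      nth_rewrite 2 [this]
      module
    rw [this, inner_sub_left, inner_smul_left]; simp
  have e₂ : inner ℝ ((1 / t₀) • (z₀ - t₀ • k₀ - x₀)) (x₁ - x₀) =
      ψ / t₀ * inner ℝ (z₁ - x₀) (x₁ - x₀) - inner ℝ k₀ (x₁ - x₀) := by
    have : (1 / t₀) • (z₀ - t₀ • k₀ - x₀) = (ψ / t₀) • (z₁ - x₀) - k₀ := by
      have h1 : k₀ = (1 / t₀) • t₀ • k₀ := by
        rw [smul_smul, one_div_mul_cancel ht₀.ne', one_smul]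
      have h2 : z₀ - x₀ = ψ • (z₁ - x₀) := by
        rw [hz₁, smul_sub, smul_add, smul_smul, smul_smul, mul_div_cancel₀ _ hψ0,
          mul_one_div_cancel hψ0]
        module
      have h3 : (ψ / t₀) • (z₁ - x₀) = (1 / t₀) • (z₀ - x₀) := by
        rw [h2, smul_smul]; congr 1; ring
      rw [h3]
      nth_rewrite 2 [h1]
      module
    rw [this, inner_sub_left, inner_smul_left]; simp
  have hbt : 0 < b * t₁ := by positivity
  have e₃ : inner ℝ ((1 / (b * t₁)) • (y₀ + (b * t₁) • K x₀ - y₁)) (yb - y₁) =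
      1 / (b * t₁) * inner ℝ (y₀ - y₁) (yb - y₁) + inner ℝ (K x₀) (yb - y₁) := by
    have : (1 / (b * t₁)) • (y₀ + (b * t₁) • K x₀ - y₁) =
        (1 / (b * t₁)) • (y₀ - y₁) + K x₀ := by
      have h1 : K x₀ = (1 / (b * t₁)) • (b * t₁) • K x₀ := by
        rw [smul_smul, one_div_mul_cancel hbt.ne', one_smul]
      nth_rewrite 2 [h1]
      module
    rw [this, inner_add_left, inner_smul_left]; simp
  rw [e₁] at h₁
  rw [e₂] at h₂
  rw [e₃] at h₃
  have i₁ := two_mul_inner_sub_sub z₁ x₁ xb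
  have i₂ := two_mul_inner_sub_sub z₁ x₀ x₁
  have i₃ := two_mul_inner_sub_sub y₀ y₁ yb
  rw [norm_sub_rev xb x₁] at h₁
  rw [norm_sub_rev x₀ x₁, norm_sub_rev z₁ x₁] at i₂
  have hcoup : -inner ℝ k₁ (xb - x₁) - inner ℝ k₀ (x₁ - x₀) + inner ℝ (K x₀) (yb - y₁) =
      inner ℝ (K x₀) yb - inner ℝ (K xb) y₁ + inner ℝ (k₁ - k₀) (x₁ - x₀) := by
    have j1 : inner ℝ (K x₀) y₁ = inner ℝ k₁ x₀ := by
      rw [hk₁, LinearMap.adjoint_inner_left, real_inner_comm]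
    have j2 : inner ℝ (K xb) y₁ = inner ℝ k₁ xb := by
      rw [hk₁, LinearMap.adjoint_inner_left, real_inner_comm]
    simp only [inner_sub_left, inner_sub_right, j1, j2]
    ring
  have hN : |inner ℝ (k₁ - k₀) (x₁ - x₀)| ≤ ‖k₁ - k₀‖ * ‖x₁ - x₀‖ := abs_real_inner_le_norm _ _
  have hsq : b * t₁ * ‖k₁ - k₀‖ ^ 2 ≤ ψ / t₀ * ‖y₁ - y₀‖ ^ 2 := by
    have := pow_le_pow_left₀ (by positivity) hacc 2
    rwa [mul_pow, mul_pow, Real.sq_sqrt (by positivity), Real.sq_sqrt (by positivity)] at this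
  -- Young's inequality for the coupling term: the squared acceptance test is precisely the
  -- discriminant condition.
  have hcross : 0 ≤ b * ψ * (t₁ / t₀) * ‖x₁ - x₀‖ ^ 2 + ‖y₁ - y₀‖ ^ 2 +
      2 * (b * t₁ * inner ℝ (k₁ - k₀) (x₁ - x₀)) := by
    refine neg_le_of_sq_le (c := b * t₁ * ‖k₁ - k₀‖) (by positivity) ?_ ?_
    · calc (b * t₁ * ‖k₁ - k₀‖) ^ 2 = b * t₁ * (b * t₁ * ‖k₁ - k₀‖ ^ 2) := by ring
        _ ≤ b * t₁ * (ψ / t₀ * ‖y₁ - y₀‖ ^ 2) := mul_le_mul_of_nonneg_left hsq hbt.le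
        _ = _ := by ring
    · rw [abs_mul, abs_of_pos hbt, mul_assoc (b * t₁) ‖k₁ - k₀‖]
      exact mul_le_mul_of_nonneg_left hN hbt.le
  have hP := sq_mul_norm_combo_sub_sq hψ0 x₁ z₁ xb
  rw [← hz₂] at hP
  have hφ := stepFactor_mul_sq (by linarith : 0 < ψ)
  rw [norm_sub_rev y₁ y₀] at i₃ hcross
  generalize hA : ‖z₁ - xb‖ ^ 2 = A at *
  generalize hB : ‖z₂ - xb‖ ^ 2 = B at *
  generalize ‖x₁ - xb‖ ^ 2 = P at *
  have hQ0 : 0 ≤ ‖x₁ - z₁‖ ^ 2 := by positivity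
  generalize ‖x₁ - z₁‖ ^ 2 = Q at *
  generalize ‖x₀ - z₁‖ ^ 2 = R at *
  have hS0 : 0 ≤ ‖x₁ - x₀‖ ^ 2 := by positivity
  generalize ‖x₁ - x₀‖ ^ 2 = S at *
  have hB' : b * (ψ * (1 + γ * t₁)) / (ψ - 1) * B =
      b * (1 + γ * t₁) * (P + A / (ψ - 1) - Q / ψ) := by
    have : B = ((ψ - 1) * ψ * P + ψ * A - (ψ - 1) * Q) / ψ ^ 2 := by
      rw [eq_div_iff (by positivity)]; linarith
    rw [this]
    field_simp
  have hA' : b * (ψ + γ * t₁) / (ψ - 1) * A = b * A + b * (1 + γ * t₁) * (A / (ψ - 1)) := by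
    field_simp; ring
  -- The weight of `‖x₁ - z₁‖ ^ 2` collects `1` from polarization and `1 / ψ` from the combination,
  -- which is where the factor `φ` originates.
  have hφ' : ψ * stepFactor ψ = 1 + 1 / ψ := by
    field_simp; linarith
  have m₁ := mul_le_mul_of_nonneg_left h₁ (by positivity : 0 ≤ 2 * (b * t₁))
  have m₂ := mul_le_mul_of_nonneg_left h₂ (by positivity : 0 ≤ 2 * (b * t₁))
  have m₃ := mul_le_mul_of_nonneg_left h₃ (by positivity : 0 ≤ 2 * (b * t₁))
  have c₁ : ∀ I, 2 * (b * t₁) * (1 / t₁ * I) = b * (2 * I) := fun I => by field_simp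
  have c₂ : ∀ I, 2 * (b * t₁) * (ψ / t₀ * I) = b * ψ * (t₁ / t₀) * (2 * I) := fun I => by
    field_simp
  have c₃ : ∀ I, 2 * (b * t₁) * (1 / (b * t₁) * I) = 2 * I := fun I => by field_simp
  simp only [mul_add, mul_sub, c₁, c₂, c₃, i₁, i₂, i₃] at m₁ m₂ m₃
  have hS1 : 0 ≤ b * t₁ * γ * S := by positivity
  have hQ1 : 0 ≤ b * t₁ * γ * (Q / ψ) := by positivity
  rw [hB', hA', mul_sub ψ, hφ']
  have hcoup' := congrArg (fun v => 2 * (b * t₁) * v) hcoup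
  simp only [mul_add, mul_sub] at hcoup'
  linear_combination m₁ + m₂ + m₃ + hcross + hS1 + hQ1 - hcoup'

end Energy

end GRPDA

namespace GRPDA

/-! ### Energy decay, boundedness and rates. -/

section RunEnergy

variable {X Y : Type*} [NormedAddCommGroup X] [InnerProductSpace ℝ X] [FiniteDimensional ℝ X]
  [NormedAddCommGroup Y] [InnerProductSpace ℝ Y] [FiniteDimensional ℝ Y]
  {g : X → EReal} {f : Y → EReal} {K : X →ₗ[ℝ] Y} {γ ψ μ : ℝ}
  {z x : ℕ → X} {y : ℕ → Y} {ω β τ : ℕ → ℝ}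

/-- The Lyapunov function of the accelerated method relative to a saddle point. -/
noncomputable def energy (γ ψ : ℝ) (z : ℕ → X) (y : ℕ → Y) (β τ : ℕ → ℝ) (xb : X) (yb : Y)
    (n : ℕ) : ℝ :=
  β (n + 1) * (ψ + γ * τ (n + 1)) / (ψ - 1) * ‖z (n + 2) - xb‖ ^ 2 + ‖y n - yb‖ ^ 2

theorem IsAcceleratedRun.subdiff_g (hrun : IsAcceleratedRun g f K γ ψ μ z x y ω β τ)
    (hp : ValidParams γ ψ μ) (hg : ClosedProperConvex g) (n : ℕ) : g (x (n + 1)) ≠ ⊤ ∧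
      (1 / τ n) • (z (n + 1) - τ n • LinearMap.adjoint K (y n) - x (n + 1)) ∈
        subdiff g (x (n + 1)) :=
  ⟨(hrun.x_step n).ne_top hg, (hrun.x_step n).mem_subdiff hg (hrun.tau_beta_pos hp n).1⟩

theorem IsAcceleratedRun.subdiff_conj (hrun : IsAcceleratedRun g f K γ ψ μ z x y ω β τ)
    (hp : ValidParams γ ψ μ) (hc : ClosedProperConvex (conj f)) (n : ℕ) :
    conj f (y (n + 1)) ≠ ⊤ ∧
      (1 / (β (n + 1) * τ (n + 1))) • (y n + (β (n + 1) * τ (n + 1)) • K (x (n + 1)) - y (n + 1)) ∈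
        subdiff (conj f) (y (n + 1)) := by
  obtain ⟨i, -, h, -⟩ := hrun.y_step n
  obtain ⟨hτ, hβ⟩ := hrun.tau_beta_pos hp (n + 1)
  exact ⟨IsProx.ne_top hc h, IsProx.mem_subdiff hc (mul_pos hβ hτ) h⟩

theorem IsOptimalPair.gap_nonneg {xb : X} {yb : Y} (h : IsOptimalPair g f K xb yb)
    {x : X} {y : Y} {a ab c cb : ℝ} (ha : g x = a) (hab : g xb = ab) (hc : conj f y = c)
    (hcb : conj f yb = cb) :
    0 ≤ a + inner ℝ (K x) yb - cb - (ab + inner ℝ (K xb) y - c) := by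
  have i1 := subdiff_le h.left_mem hab ha
  have i2 := subdiff_le h.right_mem hcb hc
  rw [inner_neg_adjoint_sub] at i1
  rw [inner_sub_right] at i2
  linarith

/-- The energy decreases, the decrease controlling the gap function and the residuals. -/
theorem IsAcceleratedRun.energy_succ_le (hrun : IsAcceleratedRun g f K γ ψ μ z x y ω β τ)
    (hp : ValidParams γ ψ μ) (hg : ClosedProperConvex g) (hc : ClosedProperConvex (conj f))
    (hgγ : StronglyConvex γ g) {xb : X} {yb : Y} {ab cb : ℝ} (hab : g xb = ab)
    (hcb : conj f yb = cb) (n : ℕ) {a c : ℝ} (ha : g (x (n + 1)) = a)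
    (hc' : conj f (y (n + 1)) = c) :
    energy γ ψ z y β τ xb yb (n + 1) +
      2 * (β (n + 1) * τ (n + 1)) *
        (a + inner ℝ (K (x (n + 1))) yb - cb - (ab + inner ℝ (K xb) (y (n + 1)) - c)) +
      β (n + 1) * (ψ * (stepFactor ψ - τ (n + 1) / τ n)) * ‖x (n + 2) - z (n + 2)‖ ^ 2 +
      β (n + 1) * (ψ * (τ (n + 1) / τ n)) * ‖x (n + 1) - z (n + 2)‖ ^ 2 ≤
    energy γ ψ z y β τ xb yb n := by
  obtain ⟨hτ, -⟩ := hrun.tau_beta_pos hp n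
  obtain ⟨hτ1, hβ1⟩ := hrun.tau_beta_pos hp (n + 1)
  obtain ⟨hτ2, hβ2⟩ := hrun.tau_beta_pos hp (n + 2)
  have hτle := hrun.tau_succ_le hp (n + 1)
  have hmul := hrun.beta_succ_mul hp (n + 1)
  obtain ⟨a', ha'⟩ := exists_coe_eq (hrun.subdiff_g hp hg (n + 1)).1 (hg.ne_bot _)
  have h₁ := hgγ.le (hrun.subdiff_g hp hg (n + 1)).2 ha' hab
  have h₂ := hgγ.le (hrun.subdiff_g hp hg n).2 ha ha'
  have h₃ := subdiff_le (hrun.subdiff_conj hp hc n).2 hc' hcb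
  obtain ⟨i, -, -, hacc, -⟩ := hrun.y_step n
  have key := energy_inequality hp.gamma_pos hp.one_lt hβ1 hτ hτ1 (hrun.z_step (n + 1))
    (hrun.z_step (n + 2)) h₁ h₂ h₃ hacc
  have hcoef : β (n + 2) * (ψ + γ * τ (n + 2)) / (ψ - 1) ≤
      β (n + 1) * (ψ * (1 + γ * τ (n + 1))) / (ψ - 1) := by
    refine div_le_div_of_nonneg_right ?_ (by linarith [hp.one_lt])
    rw [← hmul]
    refine mul_le_mul_of_nonneg_left ?_ hβ2.le
    have := mul_le_mul_of_nonneg_left hτle hp.gamma_pos.le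
    linarith
  have := mul_le_mul_of_nonneg_right hcoef (sq_nonneg ‖z (n + 3) - xb‖)
  rw [energy, energy]
  linarith

theorem IsAcceleratedRun.energy_nonneg (hrun : IsAcceleratedRun g f K γ ψ μ z x y ω β τ)
    (hp : ValidParams γ ψ μ) (xb : X) (yb : Y) (n : ℕ) : 0 ≤ energy γ ψ z y β τ xb yb n := by
  obtain ⟨hτ, hβ⟩ := hrun.tau_beta_pos hp (n + 1)
  obtain ⟨hγ, hψ, hφ, hφψ, hμ, hμ'⟩ := hp
  have : 0 < ψ - 1 := by linarith
  rw [energy]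
  positivity

/-- The two residual terms in the decrease of the energy. -/
theorem IsAcceleratedRun.residual_le (hrun : IsAcceleratedRun g f K γ ψ μ z x y ω β τ)
    (hp : ValidParams γ ψ μ) (hg : ClosedProperConvex g) (hc : ClosedProperConvex (conj f))
    (hgγ : StronglyConvex γ g) {xb : X} {yb : Y} (h : IsOptimalPair g f K xb yb) (n : ℕ) :
    β (n + 1) * (ψ * (stepFactor ψ - τ (n + 1) / τ n)) * ‖x (n + 2) - z (n + 2)‖ ^ 2 +
      β (n + 1) * (ψ * (τ (n + 1) / τ n)) * ‖x (n + 1) - z (n + 2)‖ ^ 2 ≤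
    energy γ ψ z y β τ xb yb n - energy γ ψ z y β τ xb yb (n + 1) ∧
    0 ≤ β (n + 1) * (ψ * (stepFactor ψ - τ (n + 1) / τ n)) * ‖x (n + 2) - z (n + 2)‖ ^ 2 ∧
    0 ≤ β (n + 1) * (ψ * (τ (n + 1) / τ n)) * ‖x (n + 1) - z (n + 2)‖ ^ 2 := by
  obtain ⟨a, ha⟩ := exists_coe_eq (hrun.subdiff_g hp hg n).1 (hg.ne_bot _)
  obtain ⟨c, hc'⟩ := exists_coe_eq (hrun.subdiff_conj hp hc n).1 (hc.ne_bot _)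
  obtain ⟨ab, hab⟩ := exists_coe_eq h.left_ne_top (hg.ne_bot _)
  obtain ⟨cb, hcb⟩ := exists_coe_eq h.right_ne_top (hc.ne_bot _)
  have h1 := hrun.energy_succ_le hp hg hc hgγ hab hcb n ha hc'
  have h2 := h.gap_nonneg ha hab hc' hcb
  obtain ⟨hτ, -⟩ := hrun.tau_beta_pos hp n
  obtain ⟨hτ1, hβ1⟩ := hrun.tau_beta_pos hp (n + 1)
  have h3 : 0 ≤ stepFactor ψ - τ (n + 1) / τ n := by
    rw [sub_nonneg, div_le_iff₀ hτ]; exact hrun.tau_succ_le hp n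
  have hψ : 0 < ψ := by linarith [hp.one_lt]
  have h4 := mul_nonneg (mul_pos two_pos (mul_pos hβ1 hτ1)).le h2
  exact ⟨by linarith, by positivity, by positivity⟩

theorem IsAcceleratedRun.energy_antitone (hrun : IsAcceleratedRun g f K γ ψ μ z x y ω β τ)
    (hp : ValidParams γ ψ μ) (hg : ClosedProperConvex g) (hc : ClosedProperConvex (conj f))
    (hgγ : StronglyConvex γ g) {xb : X} {yb : Y} (h : IsOptimalPair g f K xb yb) :
    Antitone (energy γ ψ z y β τ xb yb) := by
  refine antitone_nat_of_succ_le fun n => ?_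
  obtain ⟨h1, h2, h3⟩ := hrun.residual_le hp hg hc hgγ h n
  linarith

theorem IsAcceleratedRun.exists_primal_rate (hrun : IsAcceleratedRun g f K γ ψ μ z x y ω β τ)
    (hp : ValidParams γ ψ μ) (hg : ClosedProperConvex g) (hf : ClosedProperConvex f)
    (hc : ClosedProperConvex (conj f)) (hgγ : StronglyConvex γ g) {xb : X} {yb : Y}
    (h : IsOptimalPair g f K xb yb) :
    ∃ C₁ > 0, ∃ C₂ > 0, ∀ n : ℕ, 1 ≤ n →
      ‖z (n + 1) - xb‖ ≤ C₁ / n ∧ ‖x (n + 1) - xb‖ ≤ C₂ / n := by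
  obtain ⟨⟨c, hcp, hcβ⟩, -⟩ := hrun.growth hp hf
  set e := energy γ ψ z y β τ xb yb with he
  have hanti := hrun.energy_antitone hp hg hc hgγ h
  have hpos := hrun.tau_beta_pos hp
  have he0 := hrun.energy_nonneg hp xb yb 0
  have hψ := hp.one_lt
  have hγ := hp.gamma_pos
  have hψ1 : 0 < ψ - 1 := by linarith
  have hβz : ∀ n : ℕ, β (n + 1) * ‖z (n + 2) - xb‖ ^ 2 ≤ (ψ - 1) * e 0 := by
    intro n
    obtain ⟨hτ, hβ⟩ := hpos (n + 1)
    have h1 : β (n + 1) * (ψ + γ * τ (n + 1)) / (ψ - 1) * ‖z (n + 2) - xb‖ ^ 2 ≤ e 0 :=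
      (le_add_of_nonneg_right (sq_nonneg _)).trans (hanti n.zero_le)
    rw [div_mul_eq_mul_div, div_le_iff₀ hψ1] at h1
    have h2 : β (n + 1) * ‖z (n + 2) - xb‖ ^ 2 ≤
        β (n + 1) * ‖z (n + 2) - xb‖ ^ 2 * (ψ + γ * τ (n + 1)) :=
      le_mul_of_one_le_right (by positivity) (by nlinarith [mul_pos hγ hτ])
    linarith
  -- The summand `1` keeps the constant positive when the initial energy vanishes.
  set C := √((ψ - 1) * e 0) / c + 1 with hC
  have hCp : 0 < C := by positivity
  have hz : ∀ n : ℕ, 1 ≤ n → ‖z (n + 1) - xb‖ ≤ C / n := by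
    intro n hn
    obtain ⟨m, rfl⟩ := Nat.exists_eq_add_of_le' hn
    have hn0 : (0 : ℝ) < (m + 1 : ℕ) := by positivity
    rw [le_div_iff₀ hn0]
    have h1 : √(β (m + 1)) * ‖z (m + 2) - xb‖ ≤ √((ψ - 1) * e 0) := by
      refine Real.le_sqrt_of_sq_le ?_
      rw [mul_pow, Real.sq_sqrt (hpos _).2.le]
      exact hβz m
    have h2 := mul_le_mul_of_nonneg_right (hcβ (m + 1) hn) (norm_nonneg (z (m + 2) - xb))
    have h3 : ‖z (m + 2) - xb‖ * ((m + 1 : ℕ) : ℝ) ≤ √((ψ - 1) * e 0) / c := by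
      rw [le_div_iff₀ hcp]; linarith
    rw [hC]
    change ‖z (m + 2) - xb‖ * ((m + 1 : ℕ) : ℝ) ≤ _
    linarith
  refine ⟨C, hCp, (ψ + 1) / (ψ - 1) * C, by positivity, fun n hn => ⟨hz n hn, ?_⟩⟩
  have hn0 : (0 : ℝ) < n := by exact_mod_cast hn
  have h1 := hz n hn
  have h2 := (hz (n + 1) (by omega)).trans
    (div_le_div_of_nonneg_left hCp.le hn0 (by push_cast; linarith))
  -- The averaging step is inverted: the primal error is an extrapolation of two consecutive errors
  -- of `z`.
  have h3 : (ψ - 1) • (x (n + 1) - xb) = ψ • (z (n + 2) - xb) - (z (n + 1) - xb) := by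
    rw [hrun.z_step (n + 1), smul_sub ψ, smul_add, smul_smul, smul_smul,
      mul_div_cancel₀ _ (by linarith : ψ ≠ 0), mul_one_div_cancel (by linarith : ψ ≠ 0)]
    module
  have h4 : (ψ - 1) * ‖x (n + 1) - xb‖ ≤ ψ * ‖z (n + 2) - xb‖ + ‖z (n + 1) - xb‖ := by
    have := norm_sub_le (ψ • (z (n + 2) - xb)) (z (n + 1) - xb)
    rwa [← h3, norm_smul, norm_smul, Real.norm_of_nonneg hψ1.le,
      Real.norm_of_nonneg (by linarith)] at this
  have h5 := mul_le_mul_of_nonneg_left h2 (by linarith : 0 ≤ ψ)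
  have h6 : (ψ + 1) / (ψ - 1) * C / n = (ψ * (C / n) + C / n) / (ψ - 1) := by
    field_simp
  rw [h6, le_div_iff₀ hψ1]
  linarith

theorem IsAcceleratedRun.norm_dual_sub_le (hrun : IsAcceleratedRun g f K γ ψ μ z x y ω β τ)
    (hp : ValidParams γ ψ μ) (hg : ClosedProperConvex g) (hc : ClosedProperConvex (conj f))
    (hgγ : StronglyConvex γ g) {xb : X} {yb : Y} (h : IsOptimalPair g f K xb yb) (n : ℕ) :
    ‖y n - yb‖ ≤ √(energy γ ψ z y β τ xb yb 0) := by
  refine Real.le_sqrt_of_sq_le (le_trans ?_ (hrun.energy_antitone hp hg hc hgγ h n.zero_le))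
  obtain ⟨hτ, hβ⟩ := hrun.tau_beta_pos hp (n + 1)
  obtain ⟨hγ, hψ, -⟩ := hp
  have : 0 < ψ - 1 := by linarith
  rw [energy]
  exact le_add_of_nonneg_left (by positivity)

theorem IsAcceleratedRun.sum_gap_le (hrun : IsAcceleratedRun g f K γ ψ μ z x y ω β τ)
    (hp : ValidParams γ ψ μ) (hg : ClosedProperConvex g) (hc : ClosedProperConvex (conj f))
    (hgγ : StronglyConvex γ g) {xb : X} {yb : Y} {ab cb : ℝ} (hab : g xb = ab)
    (hcb : conj f yb = cb) {a c : ℕ → ℝ} (ha : ∀ n, 1 ≤ n → g (x n) = a n)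
    (hc' : ∀ n, 1 ≤ n → conj f (y n) = c n) (N : ℕ) :
    energy γ ψ z y β τ xb yb N + 2 * ∑ n ∈ Finset.Icc 1 N, β n * τ n *
      (a n + inner ℝ (K (x n)) yb - cb - (ab + inner ℝ (K xb) (y n) - c n)) ≤
    energy γ ψ z y β τ xb yb 0 := by
  induction N with
  | zero => simp
  | succ N ih =>
    rw [Finset.sum_Icc_succ_top (by omega)]
    have h1 := hrun.energy_succ_le hp hg hc hgγ hab hcb N (ha _ (by omega)) (hc' _ (by omega))
    obtain ⟨hτ, -⟩ := hrun.tau_beta_pos hp N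
    obtain ⟨hτ1, hβ1⟩ := hrun.tau_beta_pos hp (N + 1)
    have h3 : 0 ≤ stepFactor ψ - τ (N + 1) / τ N := by
      rw [sub_nonneg, div_le_iff₀ hτ]; exact hrun.tau_succ_le hp N
    have hψ : 0 < ψ := by linarith [hp.one_lt]
    have h4 : 0 ≤ β (N + 1) * (ψ * (stepFactor ψ - τ (N + 1) / τ N)) *
      ‖x (N + 2) - z (N + 2)‖ ^ 2 := by positivity
    have h5 : 0 ≤ β (N + 1) * (ψ * (τ (N + 1) / τ N)) * ‖x (N + 1) - z (N + 2)‖ ^ 2 := by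
      positivity
    linarith

/-- The ergodic rate of the primal-dual gap. -/
theorem IsAcceleratedRun.exists_gap_rate (hrun : IsAcceleratedRun g f K γ ψ μ z x y ω β τ)
    (hp : ValidParams γ ψ μ) (hg : ClosedProperConvex g) (hf : ClosedProperConvex f)
    (hc : ClosedProperConvex (conj f)) (hgγ : StronglyConvex γ g) {xb : X} {yb : Y}
    (h : IsOptimalPair g f K xb yb) :
    ∃ C₃ : ℝ, 0 < C₃ ∧ ∀ N : ℕ, 1 ≤ N →
      gap g f K xb yb (ergodicMean β τ x N) (ergodicMean β τ y N) ≤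
        ((C₃ / (N : ℝ) ^ 2 : ℝ) : EReal) := by
  obtain ⟨s, hs, hsw⟩ := hrun.totalWeight_ge hp hf
  have hpos := hrun.tau_beta_pos hp
  obtain ⟨ab, hab⟩ := exists_coe_eq h.left_ne_top (hg.ne_bot _)
  obtain ⟨cb, hcb⟩ := exists_coe_eq h.right_ne_top (hc.ne_bot _)
  have ha : ∀ n, 1 ≤ n → g (x n) = (g (x n)).toReal := by
    intro n hn
    obtain ⟨m, rfl⟩ := Nat.exists_eq_add_of_le' hn
    exact (EReal.coe_toReal (hrun.subdiff_g hp hg m).1 (hg.ne_bot _)).symm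
  have hc' : ∀ n, 1 ≤ n → conj f (y n) = (conj f (y n)).toReal := by
    intro n hn
    obtain ⟨m, rfl⟩ := Nat.exists_eq_add_of_le' hn
    exact (EReal.coe_toReal (hrun.subdiff_conj hp hc m).1 (hc.ne_bot _)).symm
  set a : ℕ → ℝ := fun n => (g (x n)).toReal
  set c : ℕ → ℝ := fun n => (conj f (y n)).toReal
  set e := energy γ ψ z y β τ xb yb
  have he0 : 0 ≤ e 0 := hrun.energy_nonneg hp xb yb 0
  refine ⟨(e 0 + 1) / (2 * s), by positivity, fun N hN => ?_⟩
  set S := totalWeight β τ N with hS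
  have hN0 : (0 : ℝ) < N := by exact_mod_cast hN
  have hSp : 0 < S := lt_of_lt_of_le (by positivity) (hsw N hN)
  set w : ℕ → ℝ := fun n => 1 / S * (β n * τ n) with hw
  have hw0 : ∀ n ∈ Finset.Icc 1 N, 0 ≤ w n := fun n _ =>
    mul_nonneg (by positivity) (mul_pos (hpos n).2 (hpos n).1).le
  have hw1 : ∑ n ∈ Finset.Icc 1 N, w n = 1 := by
    rw [← Finset.mul_sum]
    exact one_div_mul_cancel hSp.ne'
  have hmeanx : ergodicMean β τ x N = ∑ n ∈ Finset.Icc 1 N, w n • x n := by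
    rw [ergodicMean, Finset.smul_sum]
    simp only [smul_smul, hw, hS]
  have hmeany : ergodicMean β τ y N = ∑ n ∈ Finset.Icc 1 N, w n • y n := by
    rw [ergodicMean, Finset.smul_sum]
    simp only [smul_smul, hw, hS]
  -- Jensen's inequality is used for `g` and `conj f`; the remaining terms of the gap are affine in
  -- the averages.
  have hgle := hg.le_sum (Finset.Icc 1 N) w a x hw0 hw1
    fun n hn => (ha n (Finset.mem_Icc.1 hn).1).le
  have hcle := hc.le_sum (Finset.Icc 1 N) w c y hw0 hw1
    fun n hn => (hc' n (Finset.mem_Icc.1 hn).1).le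
  rw [← hmeanx] at hgle
  rw [← hmeany] at hcle
  obtain ⟨A, hA⟩ := exists_coe_eq (ne_top_of_le_ne_top (EReal.coe_ne_top _) hgle) (hg.ne_bot _)
  obtain ⟨B, hB⟩ := exists_coe_eq (ne_top_of_le_ne_top (EReal.coe_ne_top _) hcle) (hc.ne_bot _)
  rw [hA] at hgle
  rw [hB] at hcle
  norm_cast at hgle hcle
  rw [gap, lagrangian_coe hA hcb, lagrangian_coe hab hB]
  norm_cast
  have hsum := hrun.sum_gap_le hp hg hc hgγ hab hcb ha hc' N
  have heN := hrun.energy_nonneg hp xb yb N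
  have hix : inner ℝ (K (ergodicMean β τ x N)) yb =
      ∑ n ∈ Finset.Icc 1 N, w n * inner ℝ (K (x n)) yb := by
    rw [hmeanx, map_sum, sum_inner]
    simp [inner_smul_left]
  have hiy : inner ℝ (K xb) (ergodicMean β τ y N) =
      ∑ n ∈ Finset.Icc 1 N, w n * inner ℝ (K xb) (y n) := by
    rw [hmeany, inner_sum]
    simp [inner_smul_right]
  have hconst : ∀ r : ℝ, r = ∑ n ∈ Finset.Icc 1 N, w n * r := fun r => by
    rw [← Finset.sum_mul, hw1, one_mul]
  have hsplit : ∑ n ∈ Finset.Icc 1 N, w n * a n + inner ℝ (K (ergodicMean β τ x N)) yb - cb -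
      (ab + inner ℝ (K xb) (ergodicMean β τ y N) - ∑ n ∈ Finset.Icc 1 N, w n * c n) =
      1 / S * ∑ n ∈ Finset.Icc 1 N, β n * τ n *
      (a n + inner ℝ (K (x n)) yb - cb - (ab + inner ℝ (K xb) (y n) - c n)) := by
    have hterm : 1 / S * ∑ n ∈ Finset.Icc 1 N, β n * τ n *
        (a n + inner ℝ (K (x n)) yb - cb - (ab + inner ℝ (K xb) (y n) - c n)) =
        ∑ n ∈ Finset.Icc 1 N, (w n * a n + w n * inner ℝ (K (x n)) yb - w n * cb -
          (w n * ab + w n * inner ℝ (K xb) (y n) - w n * c n)) := by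
      rw [Finset.mul_sum]
      refine Finset.sum_congr rfl fun n _ => ?_
      simp only [hw]
      ring
    rw [hterm, Finset.sum_sub_distrib, Finset.sum_sub_distrib, Finset.sum_add_distrib,
      Finset.sum_sub_distrib, Finset.sum_add_distrib, ← hconst cb, ← hconst ab, hix, hiy]
  calc A + inner ℝ (K (ergodicMean β τ x N)) yb - cb -
        (ab + inner ℝ (K xb) (ergodicMean β τ y N) - B)
      ≤ 1 / S * ∑ n ∈ Finset.Icc 1 N, β n * τ n *
        (a n + inner ℝ (K (x n)) yb - cb - (ab + inner ℝ (K xb) (y n) - c n)) := by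
        rw [← hsplit]; linarith
    _ ≤ 1 / S * ((e 0 + 1) / 2) :=
        mul_le_mul_of_nonneg_left (by linarith) (by positivity)
    _ ≤ 1 / (s * (N : ℝ) ^ 2) * ((e 0 + 1) / 2) :=
        mul_le_mul_of_nonneg_right
          (one_div_le_one_div_of_le (by positivity) (hsw N hN)) (by positivity)
    _ = (e 0 + 1) / (2 * s) / ((N ^ 2 : ℕ) : ℝ) := by push_cast; field_simp

end RunEnergy

end GRPDA

namespace GRPDA

/-! ### Cluster points of the dual iterates. -/

section DualLimit

/-- The graph of the subdifferential is sequentially closed. -/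
theorem mem_subdiff_of_tendsto {E : Type*} [NormedAddCommGroup E] [InnerProductSpace ℝ E]
    {h : E → EReal} (hh : ClosedProperConvex h) {v u : ℕ → E} {v' u' : E}
    (hv : Tendsto v atTop (𝓝 v')) (hu : Tendsto u atTop (𝓝 u')) (hne : ∀ n, h (v n) ≠ ⊤)
    (hmem : ∀ n, u n ∈ subdiff h (v n)) : h v' ≠ ⊤ ∧ u' ∈ subdiff h v' := by
  -- Lower semicontinuity passes the subgradient inequality to the limit; one finite test point
  -- gives finiteness at `v'`, the others give the subgradient.
  have key : ∀ w (b : ℝ), h w = b → h v' ≤ ((b - inner ℝ u' (w - v') : ℝ) : EReal) := by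
    intro w b hb
    refine tendsto_le_of_lowerSemicontinuous hh.lsc hv
      (r := fun n => b - inner ℝ (u n) (w - v n))
      (tendsto_const_nhds.sub (hu.inner (tendsto_const_nhds.sub hv))) fun n => ?_
    obtain ⟨a, ha⟩ := exists_coe_eq (hne n) (hh.ne_bot _)
    have := subdiff_le (hmem n) ha hb
    rw [ha]
    norm_cast
    linarith
  obtain ⟨w, hw⟩ := hh.dom_nonempty
  obtain ⟨b, hb⟩ := exists_coe_eq (ne_of_lt hw) (hh.ne_bot _)
  have hv'ne := ne_top_of_le_ne_top (EReal.coe_ne_top _) (key w b hb)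
  refine ⟨hv'ne, ?_⟩
  obtain ⟨a, ha⟩ := exists_coe_eq hv'ne (hh.ne_bot _)
  refine mem_subdiff_of_forall_real hh.ne_bot ha fun w b hb => ?_
  have := key w b hb
  rw [ha] at this
  norm_cast at this
  linarith

variable {X Y : Type*} [NormedAddCommGroup X] [InnerProductSpace ℝ X] [FiniteDimensional ℝ X]
  [NormedAddCommGroup Y] [InnerProductSpace ℝ Y] [FiniteDimensional ℝ Y]
  {g : X → EReal} {f : Y → EReal} {K : X →ₗ[ℝ] Y} {γ ψ μ : ℝ}
  {z x : ℕ → X} {y : ℕ → Y} {ω β τ : ℕ → ℝ}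

/-- Infinitely often the stepsize is bounded below relative to `β` while one of two consecutive
stepsize ratios is favourable. -/
theorem IsAcceleratedRun.exists_frequently_step (hrun : IsAcceleratedRun g f K γ ψ μ z x y ω β τ)
    (hp : ValidParams γ ψ μ) (hf : ClosedProperConvex f) :
    ∃ κ > 0, ∃ᶠ n in atTop, κ ≤ √(β (n + 1)) * τ (n + 1) ∧
      (τ (n + 1) ≤ μ * (stepFactor ψ * τ n) ∨ τ (n + 2) = stepFactor ψ * τ (n + 1)) := by
  obtain ⟨-, κ, hκ, hfreq⟩ := hrun.growth hp hf
  obtain ⟨c, -, hdich⟩ := hrun.exists_tau_dichotomy hp hf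
  have hpos := hrun.tau_beta_pos hp
  have hβle := hrun.beta_succ_le hp
  obtain ⟨hγ, hψ, hφ, hφψ, hμ, hμ'⟩ := hp
  set φ := stepFactor ψ
  have hκ' : κ / ψ / φ ≤ κ := by
    rw [div_div]
    exact div_le_self hκ.le (by nlinarith)
  refine ⟨κ / ψ / φ, by positivity, ?_⟩
  rw [frequently_atTop] at hfreq ⊢
  intro N
  obtain ⟨n, hn, hgood⟩ := hfreq (N + 2)
  obtain ⟨m, rfl⟩ := Nat.exists_eq_add_of_le hn
  have e : N + 2 + m = N + m + 2 := by ring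
  rw [e] at hgood
  -- If the stepsize was fully extended on reaching the good index, the preceding index serves, at
  -- the cost of the factor `ψ φ` in `κ`; otherwise the backtracked ratio itself is favourable.
  rcases hdich (N + m + 1) with h | ⟨h, -⟩
  · refine ⟨N + m, by omega, ?_, Or.inr h⟩
    rw [show N + m + 1 + 1 = N + m + 2 from rfl] at h
    rw [h] at hgood
    rw [div_div, div_le_iff₀ (by positivity)]
    have h1 : √(β (N + m + 2)) ≤ ψ * √(β (N + m + 1)) := by
      refine Real.sqrt_le_iff.2 ⟨by positivity, ?_⟩
      rw [mul_pow, Real.sq_sqrt (hpos _).2.le]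
      have h2 := hβle (N + m + 1)
      have h3 := (hpos (N + m + 1)).2
      have h4 := (hpos (N + m + 2)).2
      rw [show N + m + 1 + 1 = N + m + 2 from rfl] at h2
      nlinarith [mul_pos (sub_pos.2 hφ) h4, mul_pos (mul_pos (sub_pos.2 hψ) h3) (by linarith : 0 < ψ)]
    have h2 : 0 < φ * τ (N + m + 1) := mul_pos (by linarith) (hpos _).1
    have h3 := mul_le_mul_of_nonneg_right h1 h2.le
    linarith
  · exact ⟨N + m + 1, by omega, hκ'.trans hgood, Or.inl h⟩

/-- At favourable indices the primal residual is controlled by the decrease of the energy. -/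
theorem IsAcceleratedRun.mul_residual_le (hrun : IsAcceleratedRun g f K γ ψ μ z x y ω β τ)
    (hp : ValidParams γ ψ μ) (hg : ClosedProperConvex g) (hc : ClosedProperConvex (conj f))
    (hgγ : StronglyConvex γ g) {xb : X} {yb : Y} (h : IsOptimalPair g f K xb yb) {n : ℕ}
    (hn : τ (n + 1) ≤ μ * (stepFactor ψ * τ n) ∨ τ (n + 2) = stepFactor ψ * τ (n + 1)) :
    min (ψ * (stepFactor ψ * (1 - μ))) (stepFactor ψ / ψ) *
      (β (n + 1) * ‖x (n + 2) - z (n + 2)‖ ^ 2) ≤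
    energy γ ψ z y β τ xb yb n - energy γ ψ z y β τ xb yb (n + 2) := by
  obtain ⟨i1, i2, i3⟩ := hrun.residual_le hp hg hc hgγ h n
  obtain ⟨j1, j2, j3⟩ := hrun.residual_le hp hg hc hgγ h (n + 1)
  rw [show n + 1 + 1 = n + 2 from rfl] at *
  rw [show n + 1 + 2 = n + 3 from rfl] at *
  have hz := hrun.z_step (n + 2)
  have hβ12 := hrun.le_beta_succ hp (n + 1)
  obtain ⟨hτ0, -⟩ := hrun.tau_beta_pos hp n
  obtain ⟨hτ, hβ⟩ := hrun.tau_beta_pos hp (n + 1)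
  obtain ⟨hγ, hψ, hφ, hφψ, hμ, hμ'⟩ := hp
  have hnn : 0 ≤ β (n + 1) * ‖x (n + 2) - z (n + 2)‖ ^ 2 := by positivity
  -- A backtracked ratio keeps the first residual weight positive. At ratio `φ` that weight is zero,
  -- so the second residual of the next step is used; it is the wanted one scaled by `1 / ψ`.
  rcases hn with hn | hn
  · refine (mul_le_mul_of_nonneg_right (min_le_left _ _) hnn).trans ?_
    have h1 : τ (n + 1) / τ n ≤ μ * stepFactor ψ := by
      rw [div_le_iff₀ hτ0]; linarith
    have h2 : stepFactor ψ * (1 - μ) ≤ stepFactor ψ - τ (n + 1) / τ n := by linarith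
    have h3 := mul_le_mul_of_nonneg_right (mul_le_mul_of_nonneg_left h2 (by linarith : 0 ≤ ψ)) hnn
    linarith
  · refine (mul_le_mul_of_nonneg_right (min_le_right _ _) hnn).trans ?_
    have h1 : τ (n + 2) / τ (n + 1) = stepFactor ψ := by
      rw [hn, mul_div_assoc, div_self hτ.ne', mul_one]
    have h2 : x (n + 2) - z (n + 3) = (1 / ψ) • (x (n + 2) - z (n + 2)) := by
      have h3 : x (n + 2) = ((ψ - 1) / ψ) • x (n + 2) + (1 / ψ) • x (n + 2) := by
        rw [← add_smul]
        have : (ψ - 1) / ψ + 1 / ψ = 1 := by field_simp; ring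
        rw [this, one_smul]
      rw [hz]
      nth_rewrite 1 [h3]
      module
    rw [h1, h2, norm_smul, mul_pow, Real.norm_eq_abs, sq_abs] at j1 j3
    have h3 : stepFactor ψ / ψ * (β (n + 1) * ‖x (n + 2) - z (n + 2)‖ ^ 2) ≤
        β (n + 2) * (ψ * stepFactor ψ) * ((1 / ψ) ^ 2 * ‖x (n + 2) - z (n + 2)‖ ^ 2) := by
      have h4 : β (n + 2) * (ψ * stepFactor ψ) * ((1 / ψ) ^ 2 * ‖x (n + 2) - z (n + 2)‖ ^ 2) =
          stepFactor ψ / ψ * (β (n + 2) * ‖x (n + 2) - z (n + 2)‖ ^ 2) := by field_simp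
      rw [h4]
      gcongr
    linarith

/-- Some subsequence of the dual iterates converges to a dual solution. -/
theorem IsAcceleratedRun.exists_subseq_tendsto
    (hrun : IsAcceleratedRun g f K γ ψ μ z x y ω β τ)
    (hp : ValidParams γ ψ μ) (hg : ClosedProperConvex g) (hf : ClosedProperConvex f)
    (hc : ClosedProperConvex (conj f)) (hgγ : StronglyConvex γ g) {xb : X} {yb : Y}
    (h : IsOptimalPair g f K xb yb) :
    ∃ (ys : Y) (k : ℕ → ℕ), StrictMono k ∧ Tendsto (fun j => y (k j)) atTop (𝓝 ys) ∧
      IsOptimalPair g f K xb ys := by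
  obtain ⟨κ, hκ, hfreq⟩ := hrun.exists_frequently_step hp hf
  obtain ⟨k₀, hk₀, hk₀'⟩ := extraction_of_frequently_atTop hfreq
  have hdual := hrun.norm_dual_sub_le hp hg hc hgγ h
  set e := energy γ ψ z y β τ xb yb with he
  obtain ⟨ys, -, k₁, hk₁, hlim⟩ := tendsto_subseq_of_bounded
    (Metric.isBounded_closedBall (x := yb) (r := √(e 0)))
    (x := fun j => y (k₀ j + 1)) (fun j => by simpa [dist_eq_norm] using hdual _)
  set k : ℕ → ℕ := fun j => k₀ (k₁ j) with hkdef
  have hk : StrictMono k := hk₀.comp hk₁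
  have hkt := hk.tendsto_atTop
  have hgood : ∀ j, κ ≤ √(β (k j + 1)) * τ (k j + 1) := fun j => (hk₀' (k₁ j)).1
  have hlim' : Tendsto (fun j => y (k j + 1)) atTop (𝓝 ys) := hlim
  have hanti := hrun.energy_antitone hp hg hc hgγ h
  have he0 : ∀ n, 0 ≤ e n := hrun.energy_nonneg hp xb yb
  obtain ⟨l, hl⟩ : ∃ l, Tendsto e atTop (𝓝 l) :=
    ⟨_, tendsto_atTop_ciInf hanti ⟨0, by rintro _ ⟨n, rfl⟩; exact he0 n⟩⟩
  have hpos := hrun.tau_beta_pos hp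
  obtain ⟨c, hcp, hcβ⟩ := (hrun.growth hp hf).1
  have hsqrt : Tendsto (fun n => √(β n)) atTop atTop := by
    refine tendsto_atTop_mono' atTop ?_ (tendsto_natCast_atTop_atTop.const_mul_atTop hcp)
    filter_upwards [eventually_ge_atTop 1] with n hn using hcβ n hn
  have hx : Tendsto x atTop (𝓝 xb) := by
    obtain ⟨_, _, C, _, hC⟩ := hrun.exists_primal_rate hp hg hf hc hgγ h
    rw [← tendsto_add_atTop_iff_nat 1, tendsto_iff_norm_sub_tendsto_zero]
    refine tendsto_of_tendsto_of_tendsto_of_le_of_le' tendsto_const_nhds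
      (tendsto_const_div_atTop_nhds_zero_nat C) (Eventually.of_forall fun n => norm_nonneg _) ?_
    filter_upwards [eventually_ge_atTop 1] with n hn using (hC n hn).2
  have hshift : ∀ i, Tendsto (fun j => k j + i) atTop atTop := fun i =>
    (tendsto_add_atTop_nat i).comp hkt
  -- Convergence of the energy makes `√β ‖x - z‖` vanish along these indices, and `1 / τ ≤ √β / κ`
  -- there.
  have hres : Tendsto (fun j => (1 / τ (k j + 1)) • (z (k j + 2) - x (k j + 2))) atTop (𝓝 0) := by
    set m := min (ψ * (stepFactor ψ * (1 - μ))) (stepFactor ψ / ψ) with hm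
    have hmp : 0 < m := by
      obtain ⟨hγ, hψ, hφ, hφψ, hμ, hμ'⟩ := hp
      have : 0 < 1 - μ := by linarith
      exact lt_min (by positivity) (by positivity)
    have hdiff : Tendsto (fun j => √((e (k j) - e (k j + 2)) / m) / κ) atTop (𝓝 0) := by
      have h1 : Tendsto (fun j => (e (k j) - e (k j + 2)) / m) atTop (𝓝 ((l - l) / m)) :=
        ((hl.comp hkt).sub (hl.comp (hshift 2))).div_const m
      have h2 := (Real.continuous_sqrt.tendsto _).comp h1
      simpa using h2.div_const κ
    refine squeeze_zero_norm (fun j => ?_) hdiff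
    obtain ⟨hτ, hβ⟩ := hpos (k j + 1)
    have h1 := hrun.mul_residual_le hp hg hc hgγ h (hk₀' (k₁ j)).2
    rw [norm_smul, Real.norm_of_nonneg (by positivity), norm_sub_rev, le_div_iff₀ hκ]
    have h2 : √(β (k j + 1)) * ‖x (k j + 2) - z (k j + 2)‖ ≤ √((e (k j) - e (k j + 2)) / m) := by
      refine Real.le_sqrt_of_sq_le ?_
      rw [mul_pow, Real.sq_sqrt hβ.le, le_div_iff₀ hmp, mul_comm]
      exact h1
    refine le_trans ?_ h2
    have h3 := mul_le_mul_of_nonneg_right (hgood j) (norm_nonneg (x (k j + 2) - z (k j + 2)))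
    rw [one_div_mul_eq_div, div_mul_eq_mul_div, div_le_iff₀ hτ]
    linarith
  -- Boundedness of the dual iterates suffices here, because `β τ ≥ κ √β → ∞`.
  have hdres : Tendsto (fun j => (1 / (β (k j + 1) * τ (k j + 1))) • (y (k j) - y (k j + 1)))
      atTop (𝓝 0) := by
    have hb : Tendsto (fun j => 2 * √(e 0) / (κ * √(β (k j + 1)))) atTop (𝓝 0) :=
      ((hsqrt.comp (hshift 1)).const_mul_atTop hκ).const_div_atTop _
    refine squeeze_zero_norm (fun j => ?_) hb
    obtain ⟨hτ, hβ⟩ := hpos (k j + 1)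
    have h1 : ‖y (k j) - y (k j + 1)‖ ≤ 2 * √(e 0) := by
      have := norm_sub_le (y (k j) - yb) (y (k j + 1) - yb)
      rw [sub_sub_sub_cancel_right] at this
      linarith [hdual (k j), hdual (k j + 1)]
    have h2 : κ * √(β (k j + 1)) ≤ β (k j + 1) * τ (k j + 1) := by
      have h3 := mul_le_mul_of_nonneg_right (hgood j) (Real.sqrt_nonneg (β (k j + 1)))
      have h4 := Real.mul_self_sqrt hβ.le
      calc κ * √(β (k j + 1)) ≤ √(β (k j + 1)) * τ (k j + 1) * √(β (k j + 1)) := h3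
        _ = √(β (k j + 1)) * √(β (k j + 1)) * τ (k j + 1) := by ring
        _ = _ := by rw [h4]
    rw [norm_smul, Real.norm_of_nonneg (by positivity), one_div_mul_eq_div]
    have : 0 < √(β (k j + 1)) := Real.sqrt_pos.2 hβ
    exact div_le_div₀ (by positivity) h1 (by positivity) h2
  have hKc : Continuous K := K.continuous_of_finiteDimensional
  have hKtc : Continuous (LinearMap.adjoint K) :=
    (LinearMap.adjoint K).continuous_of_finiteDimensional
  obtain ⟨hr1, hr2⟩ := mem_subdiff_of_tendsto hc (u' := K xb) hlim'
    (u := fun j => (1 / (β (k j + 1) * τ (k j + 1))) •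
      (y (k j) + (β (k j + 1) * τ (k j + 1)) • K (x (k j + 1)) - y (k j + 1)))
    (by
      have h1 := hdres.add ((hKc.tendsto xb).comp (hx.comp (hshift 1)))
      rw [zero_add] at h1
      refine h1.congr fun j => ?_
      have h2 : β (k j + 1) * τ (k j + 1) ≠ 0 := (mul_pos (hpos _).2 (hpos _).1).ne'
      simp only [Function.comp_apply]
      rw [add_sub_right_comm, smul_add, smul_smul, one_div_mul_cancel h2, one_smul])
    (fun j => (hrun.subdiff_conj hp hc (k j)).1) (fun j => (hrun.subdiff_conj hp hc (k j)).2)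
  obtain ⟨hl1, hl2⟩ := mem_subdiff_of_tendsto hg (u' := -(LinearMap.adjoint K ys))
    (hx.comp (hshift 2))
    (u := fun j => (1 / τ (k j + 1)) •
      (z (k j + 2) - τ (k j + 1) • LinearMap.adjoint K (y (k j + 1)) - x (k j + 2)))
    (by
      have h1 := hres.sub ((hKtc.tendsto ys).comp hlim')
      rw [zero_sub] at h1
      refine h1.congr fun j => ?_
      simp only [Function.comp_apply]
      rw [sub_right_comm, smul_sub _ (z (k j + 2) - x (k j + 2)), smul_smul,
        one_div_mul_cancel (hpos _).1.ne', one_smul])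
    (fun j => (hrun.subdiff_g hp hg (k j + 1)).1) (fun j => (hrun.subdiff_g hp hg (k j + 1)).2)
  exact ⟨ys, fun j => k j + 1, fun i j hij => Nat.add_lt_add_right (hk hij) 1, hlim',
    ⟨hl1, hr1, hl2, hr2⟩⟩

end DualLimit

end GRPDA

theorem theorem4p1 {X Y : Type*}
    [NormedAddCommGroup X] [InnerProductSpace ℝ X] [FiniteDimensional ℝ X]
    [NormedAddCommGroup Y] [InnerProductSpace ℝ Y] [FiniteDimensional ℝ Y]
    (g : X → EReal) (f : Y → EReal) (K : X →ₗ[ℝ] Y)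
    (hg : GRPDA.ClosedProperConvex g) (hf : GRPDA.ClosedProperConvex f)
    (hsol : ∃ x, GRPDA.IsPrimalSolution g f K x)
    (hri : ∃ x ∈ intrinsicInterior ℝ (GRPDA.dom g), K x ∈ intrinsicInterior ℝ (GRPDA.dom f))
    (γ : ℝ) (hγ : 0 < γ) (hgγ : GRPDA.StronglyConvex γ g)
    (ψ₀ ψ μ : ℝ) (hψ₀ : ψ₀ ^ 3 - ψ₀ - 1 = 0) (hψ : ψ₀ < ψ) (hψ' : ψ < Real.goldenRatio)
    (hμ : 0 < μ) (hμ' : μ < 1)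
    (z x : ℕ → X) (y : ℕ → Y) (ω β τ : ℕ → ℝ)
    (hrun : GRPDA.IsAcceleratedRun g f K γ ψ μ z x y ω β τ) :
    ∃ xs : X,
      (∀ x', GRPDA.IsPrimalSolution g f K x' ↔ x' = xs) ∧
      (∃ C₁ > 0, ∃ C₂ > 0, ∀ n : ℕ, 1 ≤ n →
        ‖z (n + 1) - xs‖ ≤ C₁ / n ∧ ‖x (n + 1) - xs‖ ≤ C₂ / n) ∧
      (∃ M : ℝ, ∀ n : ℕ, 1 ≤ n → ‖y n‖ ≤ M) ∧
      (∃ (ys : Y) (k : ℕ → ℕ), StrictMono k ∧ Tendsto (fun j => y (k j)) atTop (𝓝 ys) ∧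
        GRPDA.IsSaddlePoint g f K xs ys) ∧
      (∀ (xb : X) (yb : Y), GRPDA.IsSaddlePoint g f K xb yb →
        xb = xs ∧ ∃ C₃ : ℝ, 0 < C₃ ∧ ∀ N : ℕ, 1 ≤ N →
          GRPDA.gap g f K xb yb (GRPDA.ergodicMean β τ x N) (GRPDA.ergodicMean β τ y N) ≤
            ((C₃ / (N : ℝ) ^ 2 : ℝ) : EReal)) := by
  obtain ⟨xs, hxs⟩ := hsol
  have hp : GRPDA.ValidParams γ ψ μ :=
    { gamma_pos := hγ
      one_lt := (GRPDA.one_lt_of_cubic hψ₀).trans hψ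
      one_lt_factor := GRPDA.one_lt_stepFactor ((GRPDA.one_lt_of_cubic hψ₀).trans hψ) hψ'
      factor_lt := GRPDA.stepFactor_lt hψ₀ hψ
      mu_pos := hμ
      mu_lt_one := hμ' }
  obtain ⟨y₀, hopt⟩ := hxs.exists_isOptimalPair hg hf hri
  -- The dual solution provides a point where `conj f` is finite, which makes `conj f` closed,
  -- proper and convex.
  have hd : (GRPDA.dom (GRPDA.conj f)).Nonempty := ⟨y₀, lt_top_iff_ne_top.2 hopt.right_ne_top⟩
  have hc := hf.conj hd
  refine ⟨xs, fun x' => ⟨fun hx' => ?_, fun hx' => hx' ▸ hxs⟩,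
    hrun.exists_primal_rate hp hg hf hc hgγ hopt, ?_, ?_, fun xb yb hsad => ?_⟩
  · obtain ⟨y', hopt'⟩ := hx'.exists_isOptimalPair hg hf hri
    exact hopt'.left_unique hg hf hγ hgγ hopt
  · refine ⟨√(GRPDA.energy γ ψ z y β τ xs y₀ 0) + ‖y₀‖, fun n _ => ?_⟩
    have h1 := hrun.norm_dual_sub_le hp hg hc hgγ hopt n
    have h2 := norm_sub_norm_le (y n) y₀
    linarith
  · obtain ⟨ys, k, hk, hlim, hopt'⟩ := hrun.exists_subseq_tendsto hp hg hf hc hgγ hopt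
    exact ⟨ys, k, hk, hlim, hopt'.isSaddlePoint hg hf⟩
  · have hopt' := hsad.isOptimalPair hg hf hd
    exact ⟨hopt'.left_unique hg hf hγ hgγ hopt, hrun.exists_gap_rate hp hg hf hc hgγ hopt'⟩
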